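/- **($L^p$-dimensional logarithmic Sobolev inequality.)** Let $n\ge 1$, $q>1$, $1/p+1/q=1$. Let $V_0:\mathbb R^n\to\mathbb R$ be a $C^1$ function which is $q$-homogeneous, i.e. $V_0(\lambda x)=\lambda^q V_0(x)$ for all $\lambda\ge 0$ and $x\in\mathbb R^n$, and such that $e^{-V_0}$ is integrable. Let $\beta=\log\int e^{-V_0}\,dx$ and let $\mu$ be the probability measure on $\mathbb R^n$ with density $e^{-V_0-\beta}$. Let $V_0^*(y)=\sup_{x\in\mathbb R^n}\{x\cdot y-V_0(x)\}\in[0,+\infty]$ be the Legendre transform of $V_0$, and let $\mathrm{Ent}_\mu(g)=\int g\log g\,d\mu-\int g\,d\mu\,\log\int g\,d\mu$. Then, for every $C^1$ function $f:\mathbb R^n\to\mathbb R$ such that $\int e^f\,d\mu=1$, $$ \mathrm{Ent}_\mu(e^f)\le \frac np\log\Big(\frac pn\int V_0^*\big(\nabla(V_0-f)\big)\,e^f\,d\mu\Big)+n\,\frac{1-p}{p}+\int V_0\,e^f\,d\mu , $$ where the integrals (and the logarithm) take values in $[-\infty,+\infty]$. For $V_0(x)=|x|^2/2$ the measure $\mu$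 is the standard Gaussian measure $\gamma$ on $\mathbb R^n$, and the Bakry–Ledoux dimensional logarithmic Sobolev inequality holds: for every $C^1$ function $f$ such that $\int e^f\,d\gamma=1$ and $\int|x|^2e^f\,d\gamma<\infty$, $$ \mathrm{Ent}_\gamma(e^f)\le\frac12\int|x|^2e^f\,d\gamma-\frac n2+\frac n2\log\Big(1+\frac1n\Big(\int|\nabla f|^2e^f\,d\gamma+n-\int|x|^2e^f\,d\gamma\Big)\Big), $$ where $\int|\nabla f|^2e^f\,d\gamma$ may be $+\infty$. -/

import Mathlib

open MeasureTheory
open scoped RealInnerProductSpace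

noncomputable section

/-- `q`-homogeneity: `V (t x) = t ^ q V x` for all `t ≥ 0` and all `x`. -/
def IsHomogeneousOfDegree {n : ℕ} (q : ℝ) (V : EuclideanSpace ℝ (Fin n) → ℝ) : Prop :=
  ∀ (t : ℝ) (x : EuclideanSpace ℝ (Fin n)), 0 ≤ t → V (t • x) = t ^ q * V x

/-- The Legendre transform `W* (x) = sup_y (x · y - W y)`, with values in `(-∞, +∞]`. -/
def legendreTransform {n : ℕ} (W : EuclideanSpace ℝ (Fin n) → ℝ)
    (x : EuclideanSpace ℝ (Fin n)) : EReal :=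
  ⨆ y : EuclideanSpace ℝ (Fin n), ((⟪x, y⟫ - W y : ℝ) : EReal)

/-- The probability measure with Lebesgue density `e ^ (-V - β)`, `β = log ∫ e ^ (-V) dx`
(for `e ^ (-V)` integrable). -/
def gibbsMeasure {n : ℕ} (V : EuclideanSpace ℝ (Fin n) → ℝ) :
    Measure (EuclideanSpace ℝ (Fin n)) :=
  volume.withDensity fun x =>
    ENNReal.ofReal (Real.exp (-V x - Real.log (∫ y, Real.exp (-V y))))

/-- The integral `∫ g⁺ dμ - ∫ g⁻ dμ` in `[-∞, +∞]` of an extended real valued function; it is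
meaningful as soon as one of the two terms is finite. -/
def extIntegral {α : Type*} [MeasurableSpace α] (μ : Measure α) (g : α → EReal) : EReal :=
  ((∫⁻ x, (g x).toENNReal ∂μ : ENNReal) : EReal) -
    ((∫⁻ x, (-g x).toENNReal ∂μ : ENNReal) : EReal)

/-- The entropy `Ent_μ (g) = ∫ g log g dμ - (∫ g dμ) log (∫ g dμ)`, with values in `(-∞, +∞]`
for a nonnegative integrable `g` and a probability measure `μ`. -/
def entropy {α : Type*} [MeasurableSpace α] (μ : Measure α) (g : α → ℝ) : EReal :=
  extIntegral μ (fun x => ((g x * Real.log (g x) : ℝ) : EReal)) -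
    (((∫ x, g x ∂μ) * Real.log (∫ x, g x ∂μ) : ℝ) : EReal)

/-- The logarithm on `[0, +∞]`, with `log 0 = -∞` and `log (+∞) = +∞`
(and the value `-∞` on negative numbers). -/
def extLog (x : EReal) : EReal := ENNReal.log x.toENNReal

end

/-! Let `β = log ∫ e^{-V}` and `H = V - f + β`, so that `e^f dμ = e^{-H} dx`. Since `f = V - H + β`,
the entropy is `∫ V e^{-H} - ∫ H e^{-H} + β`, and the claim becomes the sharp Euclidean inequality
`-∫ H e^{-H} ≤ (n/p) log((p/n) ∫ V*(∇H) e^{-H}) + n(1-p)/p - log ∫ e^{-V}`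
(`neg_integral_le_log_integral`).

That inequality is Prékopa–Leindler differentiated at time zero. With `Q_s h(z) = inf_y (h(z - s y)
+ s W(y))`, `Z = ∫ e^{-h}` and `B = ∫ e^{-W}`, it reads `(1+s)^n Z^{1/(1+s)} B^{s/(1+s)} ≤ ∫ e^{-Q_s
h/(1+s)}`, with equality at `s = 0`. As `∂_s Q_s h = -W*(∇h)` at `0`, comparing derivatives yields
`Z (n - log Z + log B) ≤ ∫ e^{-h} (h + W*(∇h))` (`mul_sub_log_add_log_le_integral`). For `Z = 1` and
`W = l V`, homogeneity gives `W* = l^{1-p} V*` and `log B = log ∫ e^{-V} - (n/q) log l`; the best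
`l` produces the logarithm.

Differentiating under the integral needs `h` Lipschitz with a tame tail and `W ≥ c|v|^q`. So `V` is
replaced by `V + ε|v|^q`, and `e^{-H}` by `r = χ e^{-H} + δ (1+|x|²)^{-N}`. The Legendre term `r
W*(-∇r/r) = sup_v (-∂_v r - W(v) r)` is sublinear in `(r, ∇r)`, so it is bounded piece by piece,
`ε|v|^q` absorbing `∇χ`. Fatou's lemma then removes `χ` and `δ`, and dominated convergence removes
`ε` (`neg_integral_le_integral_sub_log`).

The Gaussian case is `p = q = 2`: expand `|x - ∇f|²` and integrate `⟪x, ∇H⟫ e^{-H}` by parts. -/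

open Set Filter Topology
open scoped ENNReal Pointwise

/-! ### Brunn–Minkowski and Prékopa–Leindler inequalities -/

/-- One-dimensional Brunn–Minkowski inequality. -/
theorem volume_add_volume_le_of_add_mem {A B C : Set ℝ} (hA : MeasurableSet A)
    (hB : MeasurableSet B) (hA0 : A.Nonempty) (hB0 : B.Nonempty)
    (h : ∀ a ∈ A, ∀ b ∈ B, a + b ∈ C) : volume A + volume B ≤ volume C := by
  have key : ∀ K ⊆ A, IsCompact K → ∀ L ⊆ B, IsCompact L → volume K + volume L ≤ volume C := by
    intro K hK cK L hL cL
    have left : ∀ b ∈ B, volume K ≤ volume C := fun b hb => by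
      rw [← measure_preimage_add_right volume (-b) K]
      refine measure_mono fun x hx => ?_
      simpa using h _ (hK hx) b hb
    have right : ∀ a ∈ A, volume L ≤ volume C := fun a ha => by
      rw [← measure_preimage_add volume (-a) L]
      refine measure_mono fun x hx => ?_
      simpa using h a ha _ (hL hx)
    rcases K.eq_empty_or_nonempty with rfl | nK
    · simpa using right _ hA0.some_mem
    rcases L.eq_empty_or_nonempty with rfl | nL
    · simpa using left _ hB0.some_mem
    -- With `a = max K` and `b = min L`, the translates `K + b` and `a + L` both lie in `C` and meet
    -- at most in the point `a + b`, so their volumes add.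
    obtain ⟨a, haK, ha⟩ := cK.exists_isGreatest nK
    obtain ⟨b, hbL, hb⟩ := cL.exists_isLeast nL
    rw [← measure_preimage_add_right volume (-b) K, ← measure_preimage_add volume (-a) L,
      ← measure_union₀]
    · refine measure_mono ?_
      rintro x (hx | hx)
      · simpa using h _ (hK hx) b (hL hbL)
      · simpa using h a (hK haK) _ (hL hx)
    · exact (cL.measurableSet.preimage (by fun_prop)).nullMeasurableSet
    · refine measure_mono_null (t := {a + b}) ?_ (by simp)
      rintro x ⟨h1, h2⟩
      have := ha h1
      have := hb h2
      simp only [mem_singleton_iff]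
      linarith
  have step : ∀ L ⊆ B, IsCompact L → volume A + volume L ≤ volume C := by
    intro L hL cL
    have hLC : volume L ≤ volume C := by
      simpa using key ∅ (empty_subset _) isCompact_empty L hL cL
    refine add_le_of_le_tsub_right_of_le hLC ?_
    rw [hA.measure_eq_iSup_isCompact]
    exact iSup₂_le fun K hK => iSup_le fun cK =>
      ENNReal.le_sub_of_add_le_right cL.measure_ne_top (key K hK cK L hL cL)
  have hAC : volume A ≤ volume C := by simpa using step ∅ (empty_subset _) isCompact_empty
  rcases eq_or_ne (volume A) ∞ with hA' | hA'
  · rw [show volume C = ∞ from top_unique (hA'.symm.le.trans hAC)]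
    exact le_top
  refine add_le_of_le_tsub_left_of_le hAC ?_
  rw [hB.measure_eq_iSup_isCompact]
  exact iSup₂_le fun L hL => iSup_le fun cL => ENNReal.le_sub_of_add_le_left hA' (step L hL cL)

theorem volume_convexComb_le {A B C : Set ℝ} {t : ℝ} (ht0 : 0 < t) (ht1 : t < 1)
    (hA : MeasurableSet A) (hB : MeasurableSet B) (hA0 : A.Nonempty) (hB0 : B.Nonempty)
    (h : ∀ a ∈ A, ∀ b ∈ B, (1 - t) * a + t * b ∈ C) :
    ENNReal.ofReal (1 - t) * volume A + ENNReal.ofReal t * volume B ≤ volume C := by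
  have h1 : 0 < 1 - t := by linarith
  have e1 := Measure.addHaar_smul volume (1 - t) A
  have e2 := Measure.addHaar_smul volume t B
  simp only [Module.finrank_self, pow_one, abs_of_pos h1, abs_of_pos ht0] at e1 e2
  rw [← e1, ← e2]
  refine volume_add_volume_le_of_add_mem (hA.const_smul₀ _) (hB.const_smul₀ _) hA0.smul_set
    hB0.smul_set ?_
  rintro _ ⟨a, ha, rfl⟩ _ ⟨b, hb, rfl⟩
  simpa using h a ha b hb

theorem ENNReal.geom_mean_le_arith_mean2 {t : ℝ} (ht0 : 0 < t) (ht1 : t < 1) (a b : ℝ≥0∞) :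
    a ^ (1 - t) * b ^ t ≤ ENNReal.ofReal (1 - t) * a + ENNReal.ofReal t * b := by
  have h1 : 0 < 1 - t := by linarith
  have hc : (1 - t)⁻¹.HolderConjugate t⁻¹ := by
    rw [Real.holderConjugate_iff]
    exact ⟨(one_lt_inv₀ h1).2 (by linarith), by simp⟩
  have := ENNReal.young_inequality (a ^ (1 - t)) (b ^ t) hc
  rw [← ENNReal.rpow_mul, ← ENNReal.rpow_mul, mul_inv_cancel₀ h1.ne', mul_inv_cancel₀ ht0.ne',
    ENNReal.rpow_one, ENNReal.rpow_one, ENNReal.ofReal_inv_of_pos h1,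
    ENNReal.ofReal_inv_of_pos ht0, ENNReal.div_eq_inv_mul, ENNReal.div_eq_inv_mul, inv_inv,
    inv_inv] at this
  exact this

/-- Layer cake, the levels `r ≥ 1` contributing empty sets. Levels below the supremum are the ones
whose superlevel sets are nonempty, as Brunn–Minkowski requires. -/
theorem lintegral_eq_lintegral_Ioo_of_le_one {f : ℝ → ℝ≥0∞} (hf : Measurable f)
    (hf1 : ∀ x, f x ≤ 1) :
    ∫⁻ x, f x = ∫⁻ r in Ioo (0 : ℝ) 1, volume {x | ENNReal.ofReal r < f x} := by
  have h1 : ∀ x, f x ≠ ∞ := fun x => ((hf1 x).trans_lt ENNReal.one_lt_top).ne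
  have := lintegral_eq_lintegral_meas_lt (volume : Measure ℝ) (f := fun x => (f x).toReal)
    (Eventually.of_forall fun x => ENNReal.toReal_nonneg) hf.ennreal_toReal.aemeasurable
  simp only [ENNReal.ofReal_toReal (h1 _)] at this
  rw [this, ← Ioo_union_Ici_eq_Ioi (zero_lt_one' ℝ),
    lintegral_union measurableSet_Ici (by
      rw [Set.disjoint_left]; exact fun x hx hx' => (not_le.2 hx.2) hx')]
  have hz : ∫⁻ r in Ici (1 : ℝ), volume {x | r < (f x).toReal} = 0 := by
    rw [setLIntegral_congr_fun (g := fun _ => 0) measurableSet_Ici]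
    · simp
    · intro r hr
      have : {x | r < (f x).toReal} = ∅ := by
        ext x
        simp only [mem_ofPred_eq, mem_empty_iff_false, iff_false, not_lt]
        exact (ENNReal.toReal_mono ENNReal.one_ne_top (hf1 x)).trans (by simpa using hr)
      simp [this]
  rw [hz, add_zero]
  refine setLIntegral_congr_fun measurableSet_Ioo fun r hr => ?_
  simp only [ENNReal.ofReal_lt_iff_lt_toReal hr.1.le (h1 _)]

/-- Prékopa–Leindler on the line for functions with supremum one. -/
theorem prekopa_leindler_real_of_iSup_eq_one {t : ℝ} (ht0 : 0 < t) (ht1 : t < 1)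
    {f g h : ℝ → ℝ≥0∞} (hf : Measurable f) (hg : Measurable g) (hh : Measurable h)
    (hf1 : ⨆ x, f x = 1) (hg1 : ⨆ x, g x = 1)
    (H : ∀ x y, f x ^ (1 - t) * g y ^ t ≤ h ((1 - t) * x + t * y)) :
    (∫⁻ x, f x) ^ (1 - t) * (∫⁻ x, g x) ^ t ≤ ∫⁻ x, h x := by
  have h1 : 0 < 1 - t := by linarith
  -- When both suprema are one, even the arithmetic mean of the integrals is bounded:
  -- Brunn–Minkowski applies to the superlevel sets at each level `r < 1`.
  refine (ENNReal.geom_mean_le_arith_mean2 ht0 ht1 _ _).trans ?_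
  have hle : ∫⁻ x, min (h x) 1 ≤ ∫⁻ x, h x := lintegral_mono fun x => min_le_left _ _
  refine le_trans ?_ hle
  rw [lintegral_eq_lintegral_Ioo_of_le_one hf (fun x => hf1 ▸ le_iSup f x),
    lintegral_eq_lintegral_Ioo_of_le_one hg (fun x => hg1 ▸ le_iSup g x),
    lintegral_eq_lintegral_Ioo_of_le_one (hh.min measurable_const) (fun x => min_le_right _ _),
    ← lintegral_const_mul' _ _ ENNReal.ofReal_ne_top,
    ← lintegral_const_mul' _ _ ENNReal.ofReal_ne_top]
  refine (le_lintegral_add _ _).trans ?_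
  refine setLIntegral_mono' measurableSet_Ioo fun r hr => ?_
  have hr1 : ENNReal.ofReal r < 1 := by simpa using hr.2
  refine volume_convexComb_le ht0 ht1 (measurableSet_lt measurable_const hf)
    (measurableSet_lt measurable_const hg) ?_ ?_ ?_
  · obtain ⟨x, hx⟩ := lt_iSup_iff.1 (hr1.trans_eq hf1.symm)
    exact ⟨x, hx⟩
  · obtain ⟨x, hx⟩ := lt_iSup_iff.1 (hr1.trans_eq hg1.symm)
    exact ⟨x, hx⟩
  intro a ha b hb
  refine lt_min (lt_of_lt_of_le ?_ (H a b)) hr1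
  have e : ENNReal.ofReal r = ENNReal.ofReal r ^ (1 - t) * ENNReal.ofReal r ^ t := by
    rw [← ENNReal.rpow_add _ _ (by simpa using hr.1) ENNReal.ofReal_ne_top]; simp
  rw [e]
  exact ENNReal.mul_lt_mul (ENNReal.rpow_lt_rpow ha h1) (ENNReal.rpow_lt_rpow hb ht0)

/-- Hypothesis and conclusion are invariant under dividing `f`, `g`, `h` by `a`, `b`, `a^(1-t) b^t`,
which normalises both suprema to one. -/
theorem prekopa_leindler_real_of_bounded {t : ℝ} (ht0 : 0 < t) (ht1 : t < 1)
    {f g h : ℝ → ℝ≥0∞} (hf : Measurable f) (hg : Measurable g) (hh : Measurable h)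
    (hf1 : ⨆ x, f x ≠ ∞) (hg1 : ⨆ x, g x ≠ ∞)
    (H : ∀ x y, f x ^ (1 - t) * g y ^ t ≤ h ((1 - t) * x + t * y)) :
    (∫⁻ x, f x) ^ (1 - t) * (∫⁻ x, g x) ^ t ≤ ∫⁻ x, h x := by
  have h1 : 0 < 1 - t := by linarith
  set a := ⨆ x, f x with ha
  set b := ⨆ x, g x with hb
  rcases eq_or_ne a 0 with a0 | a0
  · have : ∀ x, f x = 0 := fun x => le_antisymm (a0 ▸ le_iSup f x) bot_le
    simp [this, h1]
  rcases eq_or_ne b 0 with b0 | b0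
  · have : ∀ x, g x = 0 := fun x => le_antisymm (b0 ▸ le_iSup g x) bot_le
    simp [this, ht0]
  have key := prekopa_leindler_real_of_iSup_eq_one ht0 ht1 (f := fun x => a⁻¹ * f x)
    (g := fun x => b⁻¹ * g x) (h := fun x => (a⁻¹ ^ (1 - t) * b⁻¹ ^ t) * h x)
    (hf.const_mul _) (hg.const_mul _) (hh.const_mul _)
    (by rw [← ENNReal.mul_iSup, ENNReal.inv_mul_cancel a0 hf1])
    (by rw [← ENNReal.mul_iSup, ENNReal.inv_mul_cancel b0 hg1])
    (fun x y => by
      rw [ENNReal.mul_rpow_of_nonneg _ _ h1.le, ENNReal.mul_rpow_of_nonneg _ _ ht0.le,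
        mul_mul_mul_comm]
      gcongr
      exact H x y)
  rw [lintegral_const_mul _ hf, lintegral_const_mul _ hg, lintegral_const_mul _ hh,
    ENNReal.mul_rpow_of_nonneg _ _ h1.le, ENNReal.mul_rpow_of_nonneg _ _ ht0.le,
    mul_mul_mul_comm] at key
  refine (ENNReal.mul_le_mul_iff_right ?_ ?_).1 key
  · simp [ENNReal.rpow_eq_zero_iff, a0, b0, hf1, hg1]
  · refine ENNReal.mul_ne_top ?_ ?_ <;>
    simp [ENNReal.rpow_eq_top_iff, a0, b0, hf1, hg1]

/-- Prékopa–Leindler inequality on the line. -/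
theorem prekopa_leindler_real {t : ℝ} (ht0 : 0 < t) (ht1 : t < 1)
    {f g h : ℝ → ℝ≥0∞} (hf : Measurable f) (hg : Measurable g) (hh : Measurable h)
    (H : ∀ x y, f x ^ (1 - t) * g y ^ t ≤ h ((1 - t) * x + t * y)) :
    (∫⁻ x, f x) ^ (1 - t) * (∫⁻ x, g x) ^ t ≤ ∫⁻ x, h x := by
  have h1 : 0 < 1 - t := by linarith
  rcases eq_or_ne (∫⁻ x, f x) 0 with f0 | f0
  · simp [f0, h1]
  rcases eq_or_ne (∫⁻ x, g x) 0 with g0 | g0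
  · simp [g0, ht0]
  -- Truncate `f` and `g` at height `k`. Both integrals being nonzero, the limit of the product
  -- meets no `0 · ∞`.
  have lim : ∀ {u : ℝ → ℝ≥0∞}, Measurable u →
      Tendsto (fun k : ℕ => ∫⁻ x, min (u x) k) atTop (𝓝 (∫⁻ x, u x)) := by
    intro u hu
    refine lintegral_tendsto_of_tendsto_of_monotone
      (fun k => (hu.min measurable_const).aemeasurable)
      (Eventually.of_forall fun x i j hij => min_le_min_left _ (by exact_mod_cast hij))
      (Eventually.of_forall fun x => ?_)
    simpa using (tendsto_const_nhds (x := u x)).min ENNReal.tendsto_nat_nhds_top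
  refine le_of_tendsto (ENNReal.Tendsto.mul ((ENNReal.continuous_rpow_const.tendsto _).comp (lim hf))
    (Or.inl ?_) ((ENNReal.continuous_rpow_const.tendsto _).comp (lim hg)) (Or.inl ?_))
    (Eventually.of_forall fun k => ?_)
  · simp [ENNReal.rpow_eq_zero_iff, f0, h1.not_gt]
  · simp [ENNReal.rpow_eq_zero_iff, g0, ht0.not_gt]
  · refine prekopa_leindler_real_of_bounded ht0 ht1 (hf.min measurable_const)
      (hg.min measurable_const) hh ?_ ?_ fun x y => le_trans ?_ (H x y)
    · exact ((iSup_le fun x => min_le_right _ _).trans_lt (ENNReal.natCast_lt_top k)).ne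
    · exact ((iSup_le fun x => min_le_right _ _).trans_lt (ENNReal.natCast_lt_top k)).ne
    · gcongr <;> exact min_le_left _ _

/-- Prékopa–Leindler inequality on `Fin n → ℝ`. -/
theorem prekopa_leindler_pi {t : ℝ} (ht0 : 0 < t) (ht1 : t < 1) (n : ℕ) :
    ∀ {f g h : (Fin n → ℝ) → ℝ≥0∞}, Measurable f → Measurable g → Measurable h →
    (∀ x y, f x ^ (1 - t) * g y ^ t ≤ h ((1 - t) • x + t • y)) →
    (∫⁻ x, f x) ^ (1 - t) * (∫⁻ x, g x) ^ t ≤ ∫⁻ x, h x := by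
  induction n with
  | zero =>
    intro f g h hf hg hh H
    have hd : (volume : Measure (Fin 0 → ℝ)) = Measure.dirac 0 := by
      rw [volume_pi, Measure.pi_of_empty _ 0]
    simpa [hd] using H 0 0
  | succ n ih =>
    intro f g h hf hg hh H
    have e := (volume_preserving_piFinSuccAbove (fun _ : Fin (n + 1) => ℝ) 0).symm
    have me : Measurable (MeasurableEquiv.piFinSuccAbove (fun _ : Fin (n + 1) => ℝ) 0).symm :=
      MeasurableEquiv.measurable _
    have split : ∀ {u : (Fin (n + 1) → ℝ) → ℝ≥0∞}, Measurable u → ∫⁻ x, u x =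
        ∫⁻ a : ℝ, ∫⁻ y : Fin n → ℝ, u (Fin.cons a y) := by
      intro u hu
      rw [← e.lintegral_comp hu, Measure.volume_eq_prod, lintegral_prod]
      · simp [MeasurableEquiv.piFinSuccAbove, Fin.insertNthEquiv]
      · exact (hu.comp me).aemeasurable
    have mc : Measurable fun z : ℝ × (Fin n → ℝ) => (Fin.cons z.1 z.2 : Fin (n + 1) → ℝ) := by
      convert me using 2
      simp [MeasurableEquiv.piFinSuccAbove, Fin.insertNthEquiv]
    have mi : ∀ {u : (Fin (n + 1) → ℝ) → ℝ≥0∞}, Measurable u →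
        Measurable fun a : ℝ => ∫⁻ y : Fin n → ℝ, u (Fin.cons a y) := fun hu =>
      (hu.comp mc).lintegral_prod_right'
    have ms : ∀ {u : (Fin (n + 1) → ℝ) → ℝ≥0∞}, Measurable u → ∀ a : ℝ,
        Measurable fun y : Fin n → ℝ => u (Fin.cons a y) := fun hu a =>
      (hu.comp mc).comp measurable_prodMk_left
    rw [split hf, split hg, split hh]
    -- The induction hypothesis on the slices at `a`, `b` and `(1-t)a + tb` is exactly the
    -- one-dimensional hypothesis for the marginals.
    refine prekopa_leindler_real ht0 ht1 (mi hf) (mi hg) (mi hh) fun a b => ?_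
    refine ih (ms hf a) (ms hg b) (ms hh _) fun x y => ?_
    convert H (Fin.cons a x) (Fin.cons b y) using 2
    ext i
    refine Fin.cases ?_ (fun j => ?_) i <;> simp

/-- Prékopa–Leindler inequality on Euclidean space. -/
theorem prekopa_leindler {t : ℝ} (ht0 : 0 < t) (ht1 : t < 1) {n : ℕ}
    {f g h : EuclideanSpace ℝ (Fin n) → ℝ≥0∞} (hf : Measurable f) (hg : Measurable g)
    (hh : Measurable h) (H : ∀ x y, f x ^ (1 - t) * g y ^ t ≤ h ((1 - t) • x + t • y)) :
    (∫⁻ x, f x) ^ (1 - t) * (∫⁻ x, g x) ^ t ≤ ∫⁻ x, h x := by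
  have e := PiLp.volume_preserving_toLp (Fin n)
  rw [← e.lintegral_comp hf, ← e.lintegral_comp hg, ← e.lintegral_comp hh]
  exact prekopa_leindler_pi ht0 ht1 n (hf.comp e.measurable) (hg.comp e.measurable)
    (hh.comp e.measurable) fun x y => H _ _

/-! ### Young-type bounds -/

theorem exists_mul_le_rpow_add_rpow {p q c : ℝ} (hpq : p.HolderConjugate q) (hc : 0 < c) :
    ∃ K, 0 ≤ K ∧ ∀ a r : ℝ, 0 ≤ a → 0 ≤ r → a * r ≤ c * r ^ q + K * a ^ p := by
  -- Chosen so that `d ^ q / q = c`: Young's inequality for `(a/d) · (d r)` then leaves exactly `c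
  -- r^q`.
  set d : ℝ := (c * q) ^ q⁻¹ with hd
  have hq : 0 < q := hpq.symm.pos
  have hcq : 0 < c * q := by positivity
  have hd0 : 0 < d := Real.rpow_pos_of_pos hcq _
  have hdq : d ^ q = c * q := by rw [hd, ← Real.rpow_mul hcq.le, inv_mul_cancel₀ hq.ne', Real.rpow_one]
  refine ⟨(d⁻¹) ^ p / p, div_nonneg (by positivity) hpq.nonneg, fun a r ha hr => ?_⟩
  have := Real.young_inequality_of_nonneg (mul_nonneg ha (inv_pos.2 hd0).le)
    (mul_nonneg hd0.le hr) hpq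
  rw [Real.mul_rpow ha (inv_pos.2 hd0).le, Real.mul_rpow hd0.le hr, hdq] at this
  have e : a * d⁻¹ * (d * r) = a * r := by field_simp
  have e2 : c * q * r ^ q / q = c * r ^ q := by field_simp
  rw [e, e2] at this
  linarith [this, show a ^ p * d⁻¹ ^ p / p = d⁻¹ ^ p / p * a ^ p by ring]

theorem exists_forall_mul_le_rpow {q c : ℝ} (hq : 1 < q) (hc : 0 < c) (L : ℝ) :
    ∃ R, 0 < R ∧ ∀ r, R ≤ r → L * r ≤ c * r ^ q := by
  have h := ((tendsto_rpow_atTop (sub_pos.2 hq)).const_mul_atTop hc).eventually_ge_atTop L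
  obtain ⟨R, hR⟩ := eventually_atTop.1 h
  refine ⟨max R 1, by positivity, fun r hr => ?_⟩
  have hr0 : 0 < r := lt_of_lt_of_le one_pos ((le_max_right _ _).trans hr)
  have h1 := hR r ((le_max_left _ _).trans hr)
  have e : r ^ q = r ^ (q - 1) * r := by
    rw [Real.rpow_sub_one hr0.ne']; field_simp
  rw [e, ← mul_assoc]
  exact mul_le_mul_of_nonneg_right h1 hr0.le

/-! ### Hopf–Lax inf-convolution and its derivative at time zero -/

section InfConv

variable {E : Type*} [NormedAddCommGroup E] [NormedSpace ℝ E]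

/-- The Hopf–Lax inf-convolution at time `s`. -/
noncomputable def infConv (h W : E → ℝ) (s : ℝ) (z : E) : ℝ := ⨅ y, (h (z - s • y) + s * W y)

/-- The Legendre transform with real values. -/
noncomputable def dualFun (W : E → ℝ) (D : E →L[ℝ] ℝ) : ℝ := ⨆ v, (D v - W v)

variable {h W : E → ℝ} {L C s : ℝ}

/-- A displacement `s y` lowers `h` by at most `s L ‖y‖` and costs `s W y`; by `hC` the net gain is
at most `s C`. -/
theorem infConv_lower (hL : ∀ x y, |h x - h y| ≤ L * ‖x - y‖) (hC : ∀ v, L * ‖v‖ ≤ W v + C)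
    (hs : 0 ≤ s) (z y : E) : h z - s * C ≤ h (z - s • y) + s * W y := by
  have h1 := (abs_le.1 (hL z (z - s • y))).2
  have h2 := mul_le_mul_of_nonneg_left (hC y) hs
  rw [sub_sub_cancel, norm_smul, Real.norm_of_nonneg hs] at h1
  nlinarith

theorem infConv_bddBelow (hL : ∀ x y, |h x - h y| ≤ L * ‖x - y‖) (hC : ∀ v, L * ‖v‖ ≤ W v + C)
    (hs : 0 ≤ s) (z : E) : BddBelow (range fun y => h (z - s • y) + s * W y) :=
  ⟨_, forall_mem_range.2 (infConv_lower hL hC hs z)⟩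

theorem infConv_le (hL : ∀ x y, |h x - h y| ≤ L * ‖x - y‖) (hC : ∀ v, L * ‖v‖ ≤ W v + C)
    (hs : 0 ≤ s) (z y : E) : infConv h W s z ≤ h (z - s • y) + s * W y :=
  ciInf_le (infConv_bddBelow hL hC hs z) y

theorem le_infConv (hL : ∀ x y, |h x - h y| ≤ L * ‖x - y‖) (hC : ∀ v, L * ‖v‖ ≤ W v + C)
    (hs : 0 ≤ s) (z : E) : h z - s * C ≤ infConv h W s z :=
  le_ciInf (infConv_lower hL hC hs z)

theorem infConv_le_self (hL : ∀ x y, |h x - h y| ≤ L * ‖x - y‖) (hC : ∀ v, L * ‖v‖ ≤ W v + C)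
    (hW0 : W 0 = 0) (hs : 0 ≤ s) (z : E) : infConv h W s z ≤ h z := by
  simpa [hW0] using infConv_le hL hC hs z 0

theorem infConv_zero (z : E) : infConv h W 0 z = h z := by simp [infConv]

theorem continuous_infConv (hL : ∀ x y, |h x - h y| ≤ L * ‖x - y‖)
    (hC : ∀ v, L * ‖v‖ ≤ W v + C) (hs : 0 ≤ s) : Continuous (infConv h W s) := by
  refine (LipschitzWith.of_le_add_mul (max L 0).toNNReal fun x y => ?_).continuous
  rw [Real.coe_toNNReal _ (le_max_right _ _), ← sub_le_iff_le_add]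
  refine le_ciInf fun v => ?_
  have h1 := infConv_le hL hC hs x v
  have h2 := (abs_le.1 (hL (x - s • v) (y - s • v))).2
  rw [sub_sub_sub_cancel_right] at h2
  have h3 := mul_le_mul_of_nonneg_right (le_max_left L 0) (norm_nonneg (x - y))
  rw [dist_eq_norm]
  linarith

theorem dualFun_bddAbove {D : E →L[ℝ] ℝ} (hD : ‖D‖ ≤ L) (hC : ∀ v, L * ‖v‖ ≤ W v + C) :
    BddAbove (range fun v => D v - W v) := by
  refine ⟨C, forall_mem_range.2 fun v => ?_⟩
  have h1 := (le_abs_self _).trans (D.le_opNorm v)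
  have h2 := mul_le_mul_of_nonneg_right hD (norm_nonneg v)
  linarith [hC v]

theorem dualFun_nonneg {D : E →L[ℝ] ℝ} (hD : ‖D‖ ≤ L) (hC : ∀ v, L * ‖v‖ ≤ W v + C)
    (hW0 : W 0 = 0) : 0 ≤ dualFun W D := by
  simpa [hW0, dualFun] using le_ciSup (dualFun_bddAbove hD hC) 0

/-- The Hamilton–Jacobi equation at time zero. The upper bound tests the infimum with one
near-maximiser of `D v - W v`. For the lower bound, `‖y‖ ≥ R` cannot go below `h z`, since there `W`
dominates the Lipschitz gain, while `‖y‖ ≤ R` stays in a ball of radius `s R`, where the first-order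
expansion of `h` is uniform. -/
theorem hasDerivWithinAt_infConv (hL : ∀ x y, |h x - h y| ≤ L * ‖x - y‖)
    (hC : ∀ v, L * ‖v‖ ≤ W v + C) (hW0 : W 0 = 0) {R : ℝ} (hR0 : 0 < R)
    (hR : ∀ v, R ≤ ‖v‖ → L * ‖v‖ ≤ W v) {z : E} {D : E →L[ℝ] ℝ} (hD : HasFDerivAt h D z)
    (hDL : ‖D‖ ≤ L) :
    HasDerivWithinAt (fun s => infConv h W s z) (-dualFun W D) (Ioi 0) 0 := by
  rw [hasDerivWithinAt_iff_tendsto_slope' (by simp), Metric.tendsto_nhds]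
  intro ε hε
  obtain ⟨v, hv⟩ := exists_lt_of_lt_ciSup (show dualFun W D - ε / 2 < ⨆ v, (D v - W v) by
    rw [dualFun]; linarith)
  have hmap : Tendsto (fun s : ℝ => z - s • v) (𝓝 0) (𝓝 z) := by
    have : Continuous fun s : ℝ => z - s • v := by fun_prop
    simpa using this.tendsto 0
  have hη : 0 < ε / 2 / R := by positivity
  have hη' : 0 < ε / 4 / (‖v‖ + 1) := by positivity
  have o1 := (hasFDerivAt_iff_isLittleO.1 hD).def hη
  have o2 := hmap.eventually ((hasFDerivAt_iff_isLittleO.1 hD).def hη')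
  obtain ⟨r, hr, hball⟩ := Metric.eventually_nhds_iff.1 o1
  have hsm : ∀ᶠ s : ℝ in 𝓝[>] 0, s < r / R := by
    filter_upwards [nhdsWithin_le_nhds (Iio_mem_nhds (show (0 : ℝ) < r / R by positivity))]
      with s hs using hs
  filter_upwards [self_mem_nhdsWithin, nhdsWithin_le_nhds o2, hsm] with s hs0 hs2 hsr
  have hs : 0 < s := hs0
  have hG := dualFun_nonneg hDL hC hW0
  have up : infConv h W s z ≤ h z + s * (-dualFun W D + 3 / 4 * ε) := by
    have a1 := infConv_le hL hC hs.le z v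
    simp only [sub_sub_cancel_left, map_neg, map_smul, smul_eq_mul, norm_neg, norm_smul,
      Real.norm_of_nonneg hs.le, Real.norm_eq_abs] at hs2
    have a2 := (abs_le.1 hs2).2
    have a3 : ε / 4 / (‖v‖ + 1) * (s * ‖v‖) ≤ s * (ε / 4) := by
      rw [div_mul_eq_mul_div, div_le_iff₀ (by positivity)]
      nlinarith [norm_nonneg v, mul_pos hs hε]
    have a4 := mul_lt_mul_of_pos_left hv hs
    nlinarith
  have low : h z + s * (-dualFun W D - ε / 2) ≤ infConv h W s z := by
    refine le_ciInf fun y => ?_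
    rcases le_total R ‖y‖ with hy | hy
    · have b1 := (abs_le.1 (hL z (z - s • y))).2
      rw [sub_sub_cancel, norm_smul, Real.norm_of_nonneg hs.le] at b1
      have b2 := mul_le_mul_of_nonneg_left (hR y hy) hs.le
      nlinarith [mul_nonneg hs.le hG, mul_pos hs hε]
    · have hd : dist (z - s • y) z < r := by
        rw [dist_eq_norm, sub_sub_cancel_left, norm_neg, norm_smul, Real.norm_of_nonneg hs.le]
        calc s * ‖y‖ ≤ s * R := by gcongr
          _ < r := (lt_div_iff₀ hR0).1 hsr
      have b1 := hball hd
      simp only [sub_sub_cancel_left, map_neg, map_smul, smul_eq_mul, norm_neg, norm_smul,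
        Real.norm_of_nonneg hs.le, Real.norm_eq_abs] at b1
      have b2 := (abs_le.1 b1).1
      have b3 : ε / 2 / R * (s * ‖y‖) ≤ s * (ε / 2) := by
        rw [div_mul_eq_mul_div, div_le_iff₀ hR0]
        nlinarith [mul_le_mul_of_nonneg_left hy (mul_pos hs hε).le]
      have b4 := mul_le_mul_of_nonneg_left (le_ciSup (dualFun_bddAbove hDL hC) y) hs.le
      change s * (D y - W y) ≤ s * dualFun W D at b4
      nlinarith
  rw [slope_def_field, infConv_zero, sub_zero, Real.dist_eq, abs_lt]
  constructor
  · rw [lt_sub_iff_add_lt, lt_div_iff₀ hs]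
    nlinarith [mul_pos hs hε]
  · rw [sub_lt_iff_lt_add, div_lt_iff₀ hs]
    nlinarith [mul_pos hs hε]

end InfConv

/-! ### Prékopa–Leindler for the Hopf–Lax semigroup, and its linearisation -/

/-- Prékopa–Leindler with `t = s/(1+s)`: the convex combination of `x` and `y` is `(x + s y)/(1+s)`,
and the infimum at `x + s y`, tested with `y`, is at most `h x + s W y`. Undoing the dilation by `1
+ s` gives the factor `(1+s)^n`. -/
theorem rpow_mul_rpow_le_integral_infConv {n : ℕ} {h W : EuclideanSpace ℝ (Fin n) → ℝ} {L C s : ℝ}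
    (hL : ∀ x y, |h x - h y| ≤ L * ‖x - y‖) (hC : ∀ v, L * ‖v‖ ≤ W v + C) (hs : 0 < s)
    (hhc : Continuous h) (hWc : Continuous W)
    (hh : Integrable fun x => Real.exp (-h x)) (hW : Integrable fun x => Real.exp (-W x))
    (hi : Integrable fun x => Real.exp (-infConv h W s x / (1 + s))) :
    (1 + s) ^ n * ((∫ x, Real.exp (-h x)) ^ (1 / (1 + s)) * (∫ x, Real.exp (-W x)) ^ (s / (1 + s))) ≤
      ∫ x, Real.exp (-infConv h W s x / (1 + s)) := by
  have h1s : 0 < 1 + s := by linarith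
  have e1 : 1 - s / (1 + s) = 1 / (1 + s) := by field_simp; ring
  have ht0 : 0 < s / (1 + s) := by positivity
  have ht1 : s / (1 + s) < 1 := by rw [div_lt_one h1s]; linarith
  have cI := continuous_infConv hL hC hs.le
  have hi' : Integrable fun x => Real.exp (-infConv h W s ((1 + s) • x) / (1 + s)) :=
    hi.comp_smul h1s.ne'
  have key := prekopa_leindler ht0 ht1 (f := fun x => ENNReal.ofReal (Real.exp (-h x)))
    (g := fun x => ENNReal.ofReal (Real.exp (-W x)))
    (h := fun x => ENNReal.ofReal (Real.exp (-infConv h W s ((1 + s) • x) / (1 + s))))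
    (by fun_prop) (by fun_prop)
    (by
      have : Continuous fun x : EuclideanSpace ℝ (Fin n) => infConv h W s ((1 + s) • x) :=
        cI.comp (continuous_const_smul _)
      exact (by fun_prop : Continuous fun x : EuclideanSpace ℝ (Fin n) =>
        Real.exp (-infConv h W s ((1 + s) • x) / (1 + s))).measurable.ennreal_ofReal)
    (fun x y => by
      rw [e1, ENNReal.ofReal_rpow_of_pos (Real.exp_pos _), ENNReal.ofReal_rpow_of_pos (Real.exp_pos _),
        ← ENNReal.ofReal_mul (by positivity), ← Real.exp_mul, ← Real.exp_mul, ← Real.exp_add]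
      refine ENNReal.ofReal_le_ofReal (Real.exp_le_exp.2 ?_)
      have := infConv_le hL hC hs.le (x + s • y) y
      rw [add_sub_cancel_right] at this
      have e2 : (1 + s) • ((1 / (1 + s)) • x + (s / (1 + s)) • y) = x + s • y := by
        rw [smul_add, smul_smul, smul_smul]
        congr 2 <;> field_simp
        simp
      rw [e2, le_div_iff₀ h1s]
      field_simp
      linarith)
  rw [← ofReal_integral_eq_lintegral_ofReal hh (Eventually.of_forall fun x => (Real.exp_pos _).le),
    ← ofReal_integral_eq_lintegral_ofReal hW (Eventually.of_forall fun x => (Real.exp_pos _).le),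
    ← ofReal_integral_eq_lintegral_ofReal hi' (Eventually.of_forall fun x => (Real.exp_pos _).le),
    e1, ENNReal.ofReal_rpow_of_nonneg (integral_nonneg fun x => (Real.exp_pos _).le) (by positivity),
    ENNReal.ofReal_rpow_of_nonneg (integral_nonneg fun x => (Real.exp_pos _).le) (by positivity),
    ← ENNReal.ofReal_mul (Real.rpow_nonneg (integral_nonneg fun x => (Real.exp_pos _).le) _),
    ENNReal.ofReal_le_ofReal_iff (integral_nonneg fun x => (Real.exp_pos _).le),
    Measure.integral_comp_smul volume (fun x => Real.exp (-infConv h W s x / (1 + s))),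
    finrank_euclideanSpace_fin, abs_of_pos (by positivity), smul_eq_mul,
    ← div_eq_inv_mul, le_div_iff₀ (by positivity)] at key
  linarith

theorem abs_exp_sub_one_le_mul_exp_abs (x : ℝ) : |Real.exp x - 1| ≤ |x| * Real.exp |x| := by
  rcases le_total 0 x with hx | hx
  · rw [abs_of_nonneg hx, abs_of_nonneg (by linarith [Real.one_le_exp hx])]
    have := Real.add_one_le_exp (-x)
    have h2 := Real.exp_pos x
    have h3 : Real.exp (-x) * Real.exp x = 1 := by rw [← Real.exp_add]; simp
    nlinarith
  · rw [abs_of_nonpos hx, abs_of_nonpos (by linarith [Real.exp_le_one_iff.2 hx])]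
    have := Real.add_one_le_exp x
    have := Real.one_le_exp (neg_nonneg.2 hx)
    nlinarith

/-- The linearised Prékopa–Leindler inequality. -/
theorem mul_sub_log_add_log_le_integral {n : ℕ} {h W : EuclideanSpace ℝ (Fin n) → ℝ} {L : NNReal}
    {c q : ℝ} (hc : 0 < c) (hq : 1 < q) (hWc : Continuous W) (hW0 : W 0 = 0)
    (hWq : ∀ v, c * ‖v‖ ^ q ≤ W v) (hW : Integrable fun x => Real.exp (-W x))
    (hL : LipschitzWith L h) (hd : Differentiable ℝ h)
    (hi : Integrable fun x => Real.exp (-h x + |h x| / 2)) :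
    Integrable (fun x => Real.exp (-h x) * (h x + dualFun W (fderiv ℝ h x))) ∧
    (∫ x, Real.exp (-h x)) * (n - Real.log (∫ x, Real.exp (-h x)) + Real.log (∫ x, Real.exp (-W x)))
      ≤ ∫ x, Real.exp (-h x) * (h x + dualFun W (fderiv ℝ h x)) := by
  obtain ⟨K, hK0, hK⟩ := exists_mul_le_rpow_add_rpow (Real.HolderConjugate.conjExponent hq).symm hc
  obtain ⟨R, hR0, hR⟩ := exists_forall_mul_le_rpow hq hc L
  set C := K * (L : ℝ) ^ (Real.conjExponent q) with hCdef
  have hC0 : 0 ≤ C := by positivity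
  have hC : ∀ v : EuclideanSpace ℝ (Fin n), (L : ℝ) * ‖v‖ ≤ W v + C := fun v =>
    (hK L ‖v‖ L.coe_nonneg (norm_nonneg v)).trans (by linarith [hWq v])
  have hR' : ∀ v : EuclideanSpace ℝ (Fin n), R ≤ ‖v‖ → L * ‖v‖ ≤ W v := fun v hv =>
    (hR _ hv).trans (hWq v)
  have hL' : ∀ x y, |h x - h y| ≤ L * ‖x - y‖ := fun x y => by
    simpa [Real.dist_eq, dist_eq_norm] using hL.dist_le_mul x y
  have hhc : Continuous h := hL.continuous
  have hDL : ∀ x, ‖fderiv ℝ h x‖ ≤ L := fun x => norm_fderiv_le_of_lipschitz ℝ hL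
  have hh : Integrable fun x => Real.exp (-h x) := by
    refine hi.mono' (by fun_prop) (Eventually.of_forall fun x => ?_)
    rw [Real.norm_of_nonneg (Real.exp_pos _).le]
    exact Real.exp_le_exp.2 (by linarith [abs_nonneg (h x)])
  set Z := ∫ x, Real.exp (-h x) with hZ
  set B := ∫ x, Real.exp (-W x) with hB
  have hZ0 : 0 < Z := integral_exp_pos hh
  have hB0 : 0 < B := integral_exp_pos hW
  set F : ℝ → EuclideanSpace ℝ (Fin n) → ℝ := fun s x => Real.exp (-infConv h W s x / (1 + s))
    with hF
  -- Domination of the difference quotients. The exponents differ by at most `s Y`, `Y = |h x| + C`.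
  -- One factor `e^{Y/4}` comes from `s ≤ 1/4`, another absorbs `Y` itself; their product is the
  -- `e^{|h|/2}` of the integrability hypothesis.
  have bound : ∀ s, 0 < s → s ≤ 1 / 4 → ∀ x, |F s x - Real.exp (-h x)| ≤
      s * (4 * Real.exp (C / 2) * Real.exp (-h x + |h x| / 2)) := by
    intro s hs hs4 x
    have l1 := le_infConv hL' hC hs.le x
    have l2 := infConv_le_self hL' hC hW0 hs.le x
    have h1s : 0 < 1 + s := by linarith
    set X := -infConv h W s x / (1 + s) + h x with hX
    have hXb : |X| ≤ s * (|h x| + C) := by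
      have e : X = (s * h x + (h x - infConv h W s x)) / (1 + s) := by rw [hX]; field_simp; ring
      rw [e, abs_div, abs_of_pos h1s, div_le_iff₀ h1s]
      have : |s * h x + (h x - infConv h W s x)| ≤ s * (|h x| + C) := by
        refine (abs_add_le _ _).trans ?_
        rw [abs_mul, abs_of_pos hs, abs_of_nonneg (by linarith : 0 ≤ h x - infConv h W s x)]
        linarith
      have : 0 ≤ s * (|h x| + C) := by positivity
      nlinarith
    have e : F s x - Real.exp (-h x) = Real.exp (-h x) * (Real.exp X - 1) := by
      rw [mul_sub, ← Real.exp_add, hX]; simp [hF]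
    rw [e, abs_mul, abs_of_pos (Real.exp_pos _)]
    set Y := |h x| + C with hY
    have hY0 : 0 ≤ Y := by positivity
    have m1 : |Real.exp X - 1| ≤ s * Y * Real.exp (Y / 4) :=
      (abs_exp_sub_one_le_mul_exp_abs X).trans (mul_le_mul hXb
        (Real.exp_le_exp.2 (hXb.trans (by nlinarith))) (Real.exp_pos _).le (by positivity))
    have m2 : Y ≤ 4 * Real.exp (Y / 4) := by linarith [Real.add_one_le_exp (Y / 4)]
    calc Real.exp (-h x) * |Real.exp X - 1|
        ≤ Real.exp (-h x) * (s * (4 * Real.exp (Y / 4)) * Real.exp (Y / 4)) := by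
          refine mul_le_mul_of_nonneg_left (m1.trans ?_) (Real.exp_pos _).le
          gcongr
      _ = s * (4 * (Real.exp (-h x) * (Real.exp (Y / 4) * Real.exp (Y / 4)))) := by ring
      _ = s * (4 * Real.exp (C / 2) * Real.exp (-h x + |h x| / 2)) := by
          rw [mul_assoc 4, ← Real.exp_add, ← Real.exp_add, ← Real.exp_add]
          congr 3; rw [hY]; ring
  have cF : ∀ s, 0 < s → Continuous (F s) := fun s hs => by
    have := continuous_infConv hL' hC hs.le
    fun_prop
  have iF : ∀ s, 0 < s → s ≤ 1 / 4 → Integrable (F s) := by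
    intro s hs hs4
    have : Integrable fun x => F s x - Real.exp (-h x) :=
      ((hi.const_mul (4 * Real.exp (C / 2))).const_mul s).mono'
        ((cF s hs).sub (by fun_prop)).aestronglyMeasurable
        (Eventually.of_forall fun x => bound s hs hs4 x)
    refine (this.add hh).congr (Eventually.of_forall fun x => ?_)
    simp
  have small : ∀ᶠ s : ℝ in 𝓝[>] 0, 0 < s ∧ s ≤ 1 / 4 := by
    filter_upwards [self_mem_nhdsWithin,
      nhdsWithin_le_nhds (Iic_mem_nhds (show (0 : ℝ) < 1 / 4 by norm_num))] with s h1 h2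
      using ⟨h1, h2⟩
  have hpt : ∀ x, Tendsto (fun s => (F s x - Real.exp (-h x)) / s) (𝓝[>] 0)
      (𝓝 (Real.exp (-h x) * (h x + dualFun W (fderiv ℝ h x)))) := by
    intro x
    have d1 := hasDerivWithinAt_infConv hL' hC hW0 hR0 hR' (hd x).hasFDerivAt (hDL x)
    have d2 : HasDerivWithinAt (fun s : ℝ => 1 + s) 1 (Ioi 0) 0 :=
      ((hasDerivAt_id (0 : ℝ)).const_add 1).hasDerivWithinAt
    have d3 := (d1.neg.div d2 (by norm_num)).exp
    rw [hasDerivWithinAt_iff_tendsto_slope' (by simp)] at d3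
    convert d3 using 2
    · rename_i s
      rw [slope_def_field, sub_zero]
      simp [hF, infConv_zero]
    · simp [infConv_zero]
      ring
  have lim := tendsto_integral_filter_of_dominated_convergence
    (μ := (volume : Measure (EuclideanSpace ℝ (Fin n))))
    (fun x => 4 * Real.exp (C / 2) * Real.exp (-h x + |h x| / 2))
    (F := fun s x => (F s x - Real.exp (-h x)) / s)
    (by
      filter_upwards [small] with s hs
      exact (((cF s hs.1).sub (by fun_prop)).div_const s).aestronglyMeasurable)
    (by
      filter_upwards [small] with s hs
      refine Eventually.of_forall fun x => ?_
      rw [Real.norm_eq_abs, abs_div, abs_of_pos hs.1, div_le_iff₀ hs.1, mul_comm]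
      exact bound s hs.1 hs.2 x)
    (hi.const_mul _) (Eventually.of_forall hpt)
  -- Measurability of the Legendre term comes from its being a sequential limit of continuous
  -- difference quotients.
  have hint : Integrable (fun x => Real.exp (-h x) * (h x + dualFun W (fderiv ℝ h x))) := by
    have hu : Tendsto (fun k : ℕ => 1 / ((k : ℝ) + 1)) atTop (𝓝[>] 0) :=
      tendsto_nhdsWithin_iff.2 ⟨tendsto_one_div_add_atTop_nhds_zero_nat,
        Eventually.of_forall fun k => by simp only [mem_Ioi]; positivity⟩
    refine (hi.const_mul (4 * Real.exp (C / 2))).mono'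
      (aestronglyMeasurable_of_tendsto_ae atTop (fun k => ?_)
        (Eventually.of_forall fun x => (hpt x).comp hu)) (Eventually.of_forall fun x => ?_)
    · have := (cF (1 / ((k : ℝ) + 1)) (by positivity)).sub
        (Real.continuous_exp.comp hhc.neg)
      exact (this.div_const _).aestronglyMeasurable
    · refine le_of_tendsto (hpt x).norm ?_
      filter_upwards [small] with s hs
      rw [Real.norm_eq_abs, abs_div, abs_of_pos hs.1, div_le_iff₀ hs.1, mul_comm]
      exact bound s hs.1 hs.2 x
  refine ⟨hint, ?_⟩
  have dl : HasDerivAt (fun s : ℝ => (1 + s) ^ n * (Z ^ (1 / (1 + s)) * B ^ (s / (1 + s))))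
      (Z * (n - Real.log Z + Real.log B)) 0 := by
    have a0 : HasDerivAt (fun s : ℝ => 1 + s) 1 0 := (hasDerivAt_id (0 : ℝ)).const_add 1
    have a1 := a0.pow n
    have a2 := ((hasDerivAt_const (0 : ℝ) (1 : ℝ)).div a0 (by norm_num)).const_rpow hZ0
    have a3 := ((hasDerivAt_id (0 : ℝ)).div a0 (by norm_num)).const_rpow hB0
    refine (a1.mul (a2.mul a3)).congr_deriv ?_
    simp
    ring
  have dl' := (hasDerivWithinAt_iff_tendsto_slope' (s := Ioi (0 : ℝ)) (by simp)).1
    dl.hasDerivWithinAt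
  -- Both sides equal `Z` at `s = 0`, so the inequality for small `s > 0` passes to right
  -- derivatives.
  refine le_of_tendsto_of_tendsto dl' lim ?_
  filter_upwards [small] with s hs
  rw [slope_def_field, sub_zero, integral_div, integral_sub (iF s hs.1 hs.2) hh]
  have hs0 := hs.1
  gcongr
  · exact rpow_mul_rpow_le_integral_infConv hL' hC hs.1 hhc hWc hh hW (iF s hs.1 hs.2)
  · simp [hZ]

/-! ### Regularised densities with polynomial tails -/

/-- The logarithmic tail potential `N log (1 + |x|²)`. -/
noncomputable def tailPotential {n : ℕ} (N : ℝ) (x : EuclideanSpace ℝ (Fin n)) : ℝ :=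
  N * Real.log (1 + ‖x‖ ^ 2)

section Tail

variable {n : ℕ} {N : ℝ}

theorem contDiff_tailPotential {m : WithTop ℕ∞} :
    ContDiff ℝ m (tailPotential (n := n) N) := by
  refine contDiff_const.mul (ContDiff.log (contDiff_const.add (contDiff_norm_sq ℝ)) fun x => ?_)
  positivity

theorem tailPotential_nonneg (hN : 0 ≤ N) (x : EuclideanSpace ℝ (Fin n)) :
    0 ≤ tailPotential N x :=
  mul_nonneg hN (Real.log_nonneg (by nlinarith [sq_nonneg ‖x‖]))

theorem norm_fderiv_tailPotential_le (hN : 0 ≤ N) (x : EuclideanSpace ℝ (Fin n)) :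
    ‖fderiv ℝ (tailPotential N) x‖ ≤ N := by
  have h1 : HasFDerivAt (fun y : EuclideanSpace ℝ (Fin n) => ‖y‖ ^ 2) (2 • innerSL ℝ x) x :=
    (hasStrictFDerivAt_norm_sq x).hasFDerivAt
  have h2 : HasFDerivAt (tailPotential N) (N • ((1 + ‖x‖ ^ 2)⁻¹ • (2 • innerSL ℝ x))) x :=
    ((h1.const_add 1).log (by positivity)).const_mul N
  rw [h2.fderiv, norm_smul, norm_smul, Real.norm_of_nonneg hN,
    Real.norm_of_nonneg (by positivity : (0 : ℝ) ≤ (1 + ‖x‖ ^ 2)⁻¹)]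
  have h3 : ‖2 • innerSL ℝ x‖ ≤ 2 * ‖x‖ := by
    rw [two_nsmul, two_mul]
    exact (norm_add_le _ _).trans (by rw [innerSL_apply_norm])
  have h4 : (1 + ‖x‖ ^ 2)⁻¹ * ‖2 • innerSL ℝ x‖ ≤ 1 := by
    rw [inv_mul_le_iff₀ (by positivity)]
    nlinarith [sq_nonneg (‖x‖ - 1)]
  nlinarith

theorem exp_neg_mul_tailPotential (a : ℝ) (x : EuclideanSpace ℝ (Fin n)) :
    Real.exp (-(a * tailPotential N x)) = (1 + ‖x‖ ^ 2) ^ (-(2 * (a * N)) / 2) := by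
  rw [Real.rpow_def_of_pos (by positivity), tailPotential]
  congr 1; ring

theorem integrable_exp_neg_mul_tailPotential {a : ℝ} (ha : n < 2 * (a * N)) :
    Integrable fun x : EuclideanSpace ℝ (Fin n) => Real.exp (-(a * tailPotential N x)) := by
  simp_rw [exp_neg_mul_tailPotential]
  exact integrable_rpow_neg_one_add_norm_sq (by simpa using ha)

theorem integrable_exp_neg_tailPotential (hN : n < N) :
    Integrable fun x : EuclideanSpace ℝ (Fin n) => Real.exp (-tailPotential N x) := by
  have h0 : (0 : ℝ) ≤ n := n.cast_nonneg
  simpa using integrable_exp_neg_mul_tailPotential (n := n) (N := N) (a := 1) (by linarith)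

/-- The regularised density `e^{-H} χ + δ e^{-θ}`. -/
noncomputable def regDensity (N : ℝ) (H χ : EuclideanSpace ℝ (Fin n) → ℝ) (δ : ℝ)
    (x : EuclideanSpace ℝ (Fin n)) : ℝ :=
  Real.exp (-H x) * χ x + δ * Real.exp (-tailPotential N x)

variable {H χ : EuclideanSpace ℝ (Fin n) → ℝ} {δ : ℝ}

theorem regDensity_pos (hχ : ∀ x, 0 ≤ χ x) (hδ : 0 < δ) (x : EuclideanSpace ℝ (Fin n)) :
    0 < regDensity N H χ δ x :=
  add_pos_of_nonneg_of_pos (mul_nonneg (Real.exp_pos _).le (hχ x)) (mul_pos hδ (Real.exp_pos _))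

theorem contDiff_regDensity (hH : ContDiff ℝ 1 H) (hχ : ContDiff ℝ 1 χ) :
    ContDiff ℝ 1 (regDensity N H χ δ) :=
  (hH.neg.exp.mul hχ).add (contDiff_const.mul contDiff_tailPotential.neg.exp)

theorem fderiv_regDensity (hH : ContDiff ℝ 1 H) (hχ : ContDiff ℝ 1 χ)
    (x v : EuclideanSpace ℝ (Fin n)) :
    fderiv ℝ (regDensity N H χ δ) x v =
      Real.exp (-H x) * (fderiv ℝ χ x v - χ x * fderiv ℝ H x v) -
        δ * Real.exp (-tailPotential N x) * fderiv ℝ (tailPotential N) x v := by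
  have h1 := (hH.differentiable one_ne_zero x).hasFDerivAt
  have h2 := (hχ.differentiable one_ne_zero x).hasFDerivAt
  have h3 := ((contDiff_tailPotential (N := N) (m := 1)).differentiable one_ne_zero x).hasFDerivAt
  have h4 := (h1.neg.exp.mul h2).add (h3.neg.exp.const_mul δ)
  have h5 : fderiv ℝ (regDensity N H χ δ) x = _ := h4.fderiv
  rw [h5]
  simp
  ring

/-- Off the support of `χ` the density is exactly `δ e^{-θ}`, `θ` being the tail potential. Hence
`-log` of it inherits the Lipschitz bound and the growth of `θ`, whatever `H` does at infinity. -/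
theorem exists_neg_log_regDensity_eq (hH : ContDiff ℝ 1 H) (hχ : ContDiff ℝ 1 χ)
    (hχc : HasCompactSupport χ) (hχ0 : ∀ x, 0 ≤ χ x) (hδ : 0 < δ) :
    ∃ κ : EuclideanSpace ℝ (Fin n) → ℝ, ContDiff ℝ 1 κ ∧ HasCompactSupport κ ∧
      ∀ x, -Real.log (regDensity N H χ δ x) = tailPotential N x + (-Real.log δ + κ x) := by
  have hpos : ∀ x, 0 < 1 + χ x * (Real.exp (-H x) * (Real.exp (tailPotential N x) / δ)) := fun x => by
    have := hχ0 x
    positivity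
  refine ⟨fun x => -Real.log (1 + χ x * (Real.exp (-H x) * (Real.exp (tailPotential N x) / δ))),
    ?_, ?_, fun x => ?_⟩
  · exact (ContDiff.log (contDiff_const.add (hχ.mul (hH.neg.exp.mul
      (contDiff_tailPotential.exp.div_const δ)))) fun x => (hpos x).ne').neg
  · refine hχc.mono fun x hx => ?_
    rw [Function.mem_support] at hx ⊢
    contrapose! hx
    simp [hx]
  · have e : regDensity N H χ δ x = (δ * Real.exp (-tailPotential N x)) *
        (1 + χ x * (Real.exp (-H x) * (Real.exp (tailPotential N x) / δ))) := by
      rw [regDensity, Real.exp_neg (tailPotential N x)]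
      field_simp
      ring
    rw [e, Real.log_mul (by positivity) (hpos x).ne', Real.log_mul hδ.ne' (Real.exp_pos _).ne',
      Real.log_exp]
    ring

/-- Linearised inequality for a regularised density, in terms of an integrable upper bound `M`
of the Legendre term. -/
theorem integral_regDensity_mul_log_le {W M : EuclideanSpace ℝ (Fin n) → ℝ} {c q : ℝ}
    (hc : 0 < c) (hq : 1 < q) (hWc : Continuous W) (hW0 : W 0 = 0)
    (hWq : ∀ v, c * ‖v‖ ^ q ≤ W v) (hW : Integrable fun x => Real.exp (-W x)) (hN : n < N)
    (hH : ContDiff ℝ 1 H) (hχ : ContDiff ℝ 1 χ)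
    (hχc : HasCompactSupport χ) (hχ0 : ∀ x, 0 ≤ χ x) (hδ : 0 < δ) (hM : Integrable M)
    (hle : ∀ᵐ x, ∀ v, -fderiv ℝ (regDensity N H χ δ) x v - W v * regDensity N H χ δ x ≤ M x) :
    Integrable (fun x => regDensity N H χ δ x * Real.log (regDensity N H χ δ x)) ∧
    ∫ x, regDensity N H χ δ x * Real.log (regDensity N H χ δ x) ≤ (∫ x, M x) -
      (∫ x, regDensity N H χ δ x) * (n - Real.log (∫ x, regDensity N H χ δ x) +
        Real.log (∫ x, Real.exp (-W x))) := by
  have hn0 : (0 : ℝ) ≤ n := n.cast_nonneg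
  have hN0 : 0 ≤ N := by linarith
  have hpos := regDensity_pos (N := N) (H := H) hχ0 hδ
  have hr := contDiff_regDensity (N := N) (δ := δ) hH hχ
  obtain ⟨κ, hκ, hκc, hκe⟩ := exists_neg_log_regDensity_eq (N := N) hH hχ hχc hχ0 hδ
  obtain ⟨b, hb⟩ := hκc.exists_bound_of_continuous hκ.continuous
  obtain ⟨L, hL⟩ := hκ.lipschitzWith_of_hasCompactSupport hκc one_ne_zero
  set r := regDensity N H χ δ with hrdef
  set h : EuclideanSpace ℝ (Fin n) → ℝ := fun x => -Real.log (r x) with hh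
  have hexp : ∀ x, Real.exp (-h x) = r x := fun x => by simp [hh, Real.exp_log (hpos x)]
  have hhC : ContDiff ℝ 1 h := (hr.log fun x => (hpos x).ne').neg
  have hLip : LipschitzWith (N.toNNReal + L) h := by
    have h1 : LipschitzWith N.toNNReal (tailPotential (n := n) N) :=
      lipschitzWith_of_nnnorm_fderiv_le (contDiff_tailPotential.differentiable one_ne_zero)
        fun x => by
          rw [← NNReal.coe_le_coe, coe_nnnorm, Real.coe_toNNReal _ hN0]
          exact norm_fderiv_tailPotential_le hN0 x
    have h2 : LipschitzWith (0 + L) fun x => -Real.log δ + κ x :=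
      (LipschitzWith.const _).add hL
    have := h1.add h2
    rw [zero_add] at this
    rw [show h = fun x => tailPotential N x + (-Real.log δ + κ x) from funext hκe]
    exact this
  -- The term `|h|/2` costs half of the tail, and `e^{-θ/2}` is still integrable because `N > n`.
  have hi : Integrable fun x => Real.exp (-h x + |h x| / 2) := by
    have := (integrable_exp_neg_mul_tailPotential (n := n) (N := N) (a := 1 / 2)
      (by linarith)).const_mul (Real.exp (3 / 2 * (|Real.log δ| + b)))
    refine this.mono' (by have := hhC.continuous; fun_prop) (Eventually.of_forall fun x => ?_)
    rw [Real.norm_of_nonneg (Real.exp_pos _).le, ← Real.exp_add]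
    refine Real.exp_le_exp.2 ?_
    have e : h x = tailPotential N x + (-Real.log δ + κ x) := hκe x
    have t0 := tailPotential_nonneg hN0 x
    have a1 : |-Real.log δ + κ x| ≤ |Real.log δ| + b := by
      refine (abs_add_le _ _).trans ?_
      rw [abs_neg]
      exact add_le_add le_rfl (hb x)
    have a2 : |h x| ≤ tailPotential N x + (|Real.log δ| + b) := by
      rw [e]
      refine (abs_add_le _ _).trans ?_
      rw [abs_of_nonneg t0]
      linarith
    have a3 := (abs_le.1 a1).1
    rw [e] at a2 ⊢
    linarith
  obtain ⟨k1, k2⟩ := mul_sub_log_add_log_le_integral hc hq hWc hW0 hWq hW hLip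
    (hhC.differentiable one_ne_zero) hi
  simp only [hexp] at k1 k2
  have hrh : Integrable fun x => r x * h x := by
    refine (hi.const_mul 2).mono' (hr.continuous.mul hhC.continuous).aestronglyMeasurable
      (Eventually.of_forall fun x => ?_)
    rw [norm_mul, Real.norm_of_nonneg (hpos x).le, Real.exp_add, hexp, Real.norm_eq_abs]
    have := Real.add_one_le_exp (|h x| / 2)
    have := hpos x
    nlinarith
  have hneg : (fun x => r x * Real.log (r x)) = fun x => -(r x * h x) := by
    funext x; simp [hh]
  rw [hneg, integral_neg]
  refine ⟨hrh.neg, ?_⟩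
  have hmono : ∫ x, r x * (h x + dualFun W (fderiv ℝ h x)) ≤ ∫ x, (r x * h x + M x) := by
    refine integral_mono_ae k1 (hrh.add hM) ?_
    filter_upwards [hle] with x hx
    have hrx := hpos x
    -- As `h = -log r`, the product `r W*(∇h)` is `sup_v (-∂_v r - W(v) r)`, which `M` bounds.
    have : dualFun W (fderiv ℝ h x) ≤ M x / r x := by
      refine ciSup_le fun v => ?_
      have hd : fderiv ℝ h x = -((r x)⁻¹ • fderiv ℝ r x) :=
        (((hr.differentiable one_ne_zero x).hasFDerivAt.log hrx.ne').neg).fderiv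
      rw [le_div_iff₀ hrx, hd]
      have := hx v
      have e : (-((r x)⁻¹ • fderiv ℝ r x)) v = -((r x)⁻¹ * fderiv ℝ r x v) := rfl
      rw [e]
      field_simp
      linarith
    have := mul_le_mul_of_nonneg_left this hrx.le
    rw [mul_div_cancel₀ _ hrx.ne'] at this
    linarith
  rw [integral_add hrh hM] at hmono
  linarith

end Tail

/-! ### Cutoffs and removal of the regularisation -/

/-- The gradient of the cutoff must be absorbed by `ε ‖v‖^q χ` even where `χ` is small. Powers `b^m`
of a dilated bump do this: their gradient is of order `b^(m-1) ≤ b^(m/q)` once `m ≥ p`, and Young's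
inequality leaves an error tending to `0` with the dilation. -/
theorem exists_cutoff (n : ℕ) {p q ε : ℝ} (hpq : p.HolderConjugate q) (hε : 0 < ε) :
    ∃ (χ : ℕ → EuclideanSpace ℝ (Fin n) → ℝ) (c : ℕ → ℝ), (∀ k, ContDiff ℝ 1 (χ k)) ∧
      (∀ k, HasCompactSupport (χ k)) ∧ (∀ k x, 0 ≤ χ k x) ∧ (∀ k x, χ k x ≤ 1) ∧
      (∀ x, Tendsto (fun k => χ k x) atTop (𝓝 1)) ∧ Tendsto c atTop (𝓝 0) ∧
      ∀ k x v, -fderiv ℝ (χ k) x v - ε * ‖v‖ ^ q * χ k x ≤ c k := by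
  obtain ⟨K, hK0, hK⟩ := exists_mul_le_rpow_add_rpow hpq hε
  let b : ContDiffBump (0 : EuclideanSpace ℝ (Fin n)) := ⟨1, 2, one_pos, one_lt_two⟩
  have hb1 : ContDiff ℝ 1 b := b.contDiff
  obtain ⟨B, hB⟩ := (b.hasCompactSupport.fderiv ℝ).exists_bound_of_continuous
    (hb1.continuous_fderiv one_ne_zero)
  have hB0 : 0 ≤ B := (norm_nonneg _).trans (hB 0)
  obtain ⟨m, hm⟩ := exists_nat_gt p
  have hp1 : 1 < p := hpq.lt
  have hm1 : 1 < m := by exact_mod_cast hp1.trans hm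
  have hq := hpq.symm.pos
  set a : ℕ → ℝ := fun k => ((k : ℝ) + 1)⁻¹ with ha
  have ha0 : ∀ k, 0 < a k := fun k => by positivity
  have hlim : Tendsto a atTop (𝓝 0) := by
    simpa [ha, one_div] using tendsto_one_div_add_atTop_nhds_zero_nat (𝕜 := ℝ)
  refine ⟨fun k x => b (a k • x) ^ m, fun k => K * (m * B * a k) ^ p, fun k => ?_, fun k => ?_,
    fun k x => pow_nonneg b.nonneg _, fun k x => pow_le_one₀ b.nonneg b.le_one, fun x => ?_, ?_,
    fun k x v => ?_⟩
  · exact (hb1.comp (contDiff_const_smul _)).pow m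
  · have := (b.hasCompactSupport.comp_smul (ha0 k).ne').comp_left (g := fun y : ℝ => y ^ m)
      (zero_pow (by omega))
    exact this
  · refine tendsto_const_nhds.congr' ?_
    have h1 : Tendsto (fun k => a k * ‖x‖) atTop (𝓝 0) := by simpa using hlim.mul_const ‖x‖
    filter_upwards [h1.eventually (Iic_mem_nhds one_pos)] with k hk
    rw [b.one_of_mem_closedBall, one_pow]
    simpa [norm_smul, abs_of_pos (ha0 k)] using hk
  · have : Tendsto (fun k => K * (m * B * a k) ^ p) atTop (𝓝 (K * (m * B * 0) ^ p)) :=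
      ((hlim.const_mul _).rpow_const (Or.inr hpq.nonneg)).const_mul K
    simpa [Real.zero_rpow hpq.ne_zero] using this
  · have hd : HasFDerivAt (fun x => b (a k • x) ^ m)
        ((m * b (a k • x) ^ (m - 1)) • ((fderiv ℝ b (a k • x)).comp
          (a k • ContinuousLinearMap.id ℝ (EuclideanSpace ℝ (Fin n))))) x := by
      have h1 := ((hb1.differentiable one_ne_zero (a k • x)).hasFDerivAt.comp x
        ((hasFDerivAt_id x).const_smul (a k))).pow m
      refine h1.congr_fderiv ?_
      simp only [Function.comp_apply, nsmul_eq_mul]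
    rw [hd.fderiv]
    set y := b (a k • x) with hy
    have hy0 : 0 ≤ y := b.nonneg
    have hy1 : y ≤ 1 := b.le_one
    have e : ((m * y ^ (m - 1)) • ((fderiv ℝ b (a k • x)).comp
          (a k • ContinuousLinearMap.id ℝ (EuclideanSpace ℝ (Fin n))))) v =
        m * y ^ (m - 1) * (a k * fderiv ℝ b (a k • x) v) := by simp
    rw [e]
    have h2 : -fderiv ℝ b (a k • x) v ≤ B * ‖v‖ :=
      (neg_le_abs _).trans (((fderiv ℝ b (a k • x)).le_opNorm v).trans
        (mul_le_mul_of_nonneg_right (hB _) (norm_nonneg v)))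
    have h3 : y ^ (m - 1) ≤ y ^ ((m : ℝ) / q) := by
      rw [← Real.rpow_natCast]
      rcases hy0.eq_or_lt with h0 | h0
      · rw [← h0, Real.zero_rpow, Real.zero_rpow]
        · positivity
        · rw [Nat.cast_ne_zero]; omega
      · refine Real.rpow_le_rpow_of_exponent_ge h0 hy1 ?_
        rw [Nat.cast_sub hm1.le, Nat.cast_one, div_eq_mul_inv,
          show q⁻¹ = 1 - p⁻¹ from eq_sub_of_add_eq' hpq.inv_add_inv_eq_one]
        have : 1 ≤ (m : ℝ) * p⁻¹ := by
          rw [← div_eq_mul_inv, le_div_iff₀ hpq.pos]; linarith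
        linarith
    have h4 := hK (m * B * a k) (‖v‖ * y ^ ((m : ℝ) / q)) (by have := ha0 k; positivity)
      (by positivity)
    have h5 : (‖v‖ * y ^ ((m : ℝ) / q)) ^ q = ‖v‖ ^ q * y ^ m := by
      rw [Real.mul_rpow (norm_nonneg v) (by positivity), ← Real.rpow_mul hy0,
        div_mul_cancel₀ _ hq.ne', Real.rpow_natCast]
    rw [h5] at h4
    have h6 : -(m * y ^ (m - 1) * (a k * fderiv ℝ b (a k • x) v)) ≤
        m * B * a k * (‖v‖ * y ^ ((m : ℝ) / q)) := by
      calc -(m * y ^ (m - 1) * (a k * fderiv ℝ b (a k • x) v))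
          = (m * a k * y ^ (m - 1)) * (-fderiv ℝ b (a k • x) v) := by ring
        _ ≤ (m * a k * y ^ (m - 1)) * (B * ‖v‖) := by
          have := ha0 k
          gcongr
        _ ≤ (m * a k * y ^ ((m : ℝ) / q)) * (B * ‖v‖) := by
          have := ha0 k
          gcongr
        _ = _ := by ring
    linarith

theorem IsHomogeneousOfDegree.apply_zero {n : ℕ} {q : ℝ} {V : EuclideanSpace ℝ (Fin n) → ℝ}
    (hV : IsHomogeneousOfDegree q V) (hq : 0 < q) : V 0 = 0 := by
  simpa [Real.zero_rpow hq.ne'] using hV 0 0 le_rfl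

theorem IsHomogeneousOfDegree.exists_le {n : ℕ} {q : ℝ} {V : EuclideanSpace ℝ (Fin n) → ℝ}
    (hV : IsHomogeneousOfDegree q V) (hq : 0 < q) (hc : Continuous V) :
    ∃ C, 0 ≤ C ∧ ∀ x, |V x| ≤ C * ‖x‖ ^ q := by
  obtain ⟨C, hC⟩ := (isCompact_closedBall (0 : EuclideanSpace ℝ (Fin n)) 1).exists_bound_of_continuousOn
    hc.continuousOn
  have hC0 : 0 ≤ C := (norm_nonneg _).trans (hC 0 (by simp))
  refine ⟨C, hC0, fun x => ?_⟩
  rcases eq_or_ne x 0 with rfl | hx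
  · simp [hV.apply_zero hq, Real.zero_rpow hq.ne']
  · have hx' : 0 < ‖x‖ := norm_pos_iff.2 hx
    have h1 := hV ‖x‖ (‖x‖⁻¹ • x) hx'.le
    rw [smul_smul, mul_inv_cancel₀ hx'.ne', one_smul] at h1
    rw [h1, abs_mul, abs_of_nonneg (by positivity), mul_comm]
    gcongr
    exact hC _ (by simp [norm_smul, hx'.ne'])

theorem integrable_mul_exp_neg_tailPotential {n : ℕ} {q N : ℝ} {V : EuclideanSpace ℝ (Fin n) → ℝ}
    (hV : IsHomogeneousOfDegree q V) (hq : 0 < q) (hc : Continuous V) (hN : n + q < N) :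
    Integrable fun x => V x * Real.exp (-tailPotential N x) := by
  obtain ⟨C, hC0, hC⟩ := hV.exists_le hq hc
  have hn0 : (0 : ℝ) ≤ n := n.cast_nonneg
  have hi := (integrable_rpow_neg_one_add_norm_sq (E := EuclideanSpace ℝ (Fin n)) (μ := volume)
    (r := 2 * N - q) (by simp; linarith)).const_mul C
  have hcont : Continuous (tailPotential (n := n) N) := (contDiff_tailPotential (m := 1)).continuous
  refine hi.mono' (by fun_prop) (Eventually.of_forall fun x => ?_)
  have e := exp_neg_mul_tailPotential (N := N) 1 x
  rw [one_mul] at e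
  rw [norm_mul, Real.norm_eq_abs, Real.norm_of_nonneg (Real.exp_pos _).le, e]
  have h1 : ‖x‖ ^ q ≤ (1 + ‖x‖ ^ 2) ^ (q / 2) := by
    have : ‖x‖ ^ q = (‖x‖ ^ 2) ^ (q / 2) := by
      rw [← Real.rpow_natCast, ← Real.rpow_mul (norm_nonneg x)]
      congr 1; push_cast; ring
    rw [this]
    gcongr
    linarith
  calc |V x| * (1 + ‖x‖ ^ 2) ^ (-(2 * (1 * N)) / 2)
      ≤ (C * (1 + ‖x‖ ^ 2) ^ (q / 2)) * (1 + ‖x‖ ^ 2) ^ (-(2 * (1 * N)) / 2) := by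
        gcongr
        exact (hC x).trans (by gcongr)
    _ = C * (1 + ‖x‖ ^ 2) ^ (-(2 * N - q) / 2) := by
        rw [mul_assoc, ← Real.rpow_add (by positivity)]
        congr 2; ring

theorem integral_add_add {α : Type*} [MeasurableSpace α] {μ : Measure α} {f g h : α → ℝ}
    (hf : Integrable f μ) (hg : Integrable g μ) (hh : Integrable h μ) :
    ∫ x, (f x + g x + h x) ∂μ = ∫ x, f x ∂μ + ∫ x, g x ∂μ + ∫ x, h x ∂μ := by
  rw [integral_add (f := fun x => f x + g x) (hf.add hg) hh, integral_add hf hg]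

/-- Fenchel duality between `a log a - a` and `exp`. It makes the entropy integrand nonnegative
after adding convergent terms, as Fatou's lemma needs. -/
theorem mul_log_add_mul_add_exp_neg_nonneg {a : ℝ} (ha : 0 < a) (V : ℝ) :
    0 ≤ a * Real.log a + V * a + Real.exp (-V) := by
  have h := Real.add_one_le_exp (-V - Real.log a)
  rw [Real.exp_sub, Real.exp_log ha, le_div_iff₀ ha] at h
  nlinarith

/-- Linearised Euclidean logarithmic Sobolev inequality with a regularised potential
`W = U + ε |v|^q`. -/
theorem neg_integral_le_of_fderiv_sub_le {n : ℕ} {p q ε : ℝ} (hpq : p.HolderConjugate q)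
    (hε : 0 < ε) {V U H D : EuclideanSpace ℝ (Fin n) → ℝ}
    (hV : IsHomogeneousOfDegree q V) (hVc : Continuous V)
    (hVi : Integrable fun x => Real.exp (-V x))
    (hUc : Continuous U) (hU0 : U 0 = 0) (hUn : ∀ v, 0 ≤ U v)
    (hUi : Integrable fun x => Real.exp (-U x))
    (hH : ContDiff ℝ 1 H) (hHi : Integrable fun x => Real.exp (-H x))
    (hH1 : ∫ x, Real.exp (-H x) = 1) (hVH : Integrable fun x => V x * Real.exp (-H x))
    (hD : Integrable fun x => D x * Real.exp (-H x))
    (hle : ∀ᵐ x, ∀ v, fderiv ℝ H x v - U v ≤ D x) :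
    Integrable (fun x => H x * Real.exp (-H x)) ∧
    -∫ x, H x * Real.exp (-H x) ≤ (∫ x, D x * Real.exp (-H x)) - n -
      Real.log (∫ x, Real.exp (-(U x + ε * ‖x‖ ^ q))) := by
  have hq1 : 1 < q := hpq.symm.lt
  have hq := hpq.symm.pos
  have hHc := hH.continuous
  obtain ⟨χ, c, hχ, hχc, hχ0, hχ1, hχlim, hc, hχle⟩ := exists_cutoff n hpq hε
  obtain ⟨K, hK0, hK⟩ := exists_mul_le_rpow_add_rpow hpq hε
  set N : ℝ := n + q + 1 with hNdef
  have hn0 : (0 : ℝ) ≤ n := n.cast_nonneg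
  have hN : (n : ℝ) < N := by linarith
  have hN0 : 0 ≤ N := by linarith
  set δ : ℕ → ℝ := fun k => ((k : ℝ) + 1)⁻¹ with hδdef
  have hδ0 : ∀ k, 0 < δ k := fun k => by positivity
  have hδ1 : ∀ k, δ k ≤ 1 := fun k => by
    have : (0 : ℝ) ≤ k := k.cast_nonneg
    exact inv_le_one_of_one_le₀ (by linarith)
  have hδ : Tendsto δ atTop (𝓝 0) := by
    simpa [hδdef, one_div] using tendsto_one_div_add_atTop_nhds_zero_nat (𝕜 := ℝ)
  set W : EuclideanSpace ℝ (Fin n) → ℝ := fun x => U x + ε * ‖x‖ ^ q with hWdef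
  have hWc : Continuous W := hUc.add (continuous_const.mul (continuous_norm.rpow_const
    fun x => Or.inr hq.le))
  have hW0 : W 0 = 0 := by simp [hWdef, hU0, Real.zero_rpow hq.ne']
  have hWq : ∀ v, ε * ‖v‖ ^ q ≤ W v := fun v => by simp only [hWdef]; linarith [hUn v]
  have hWi : Integrable fun x => Real.exp (-W x) := by
    refine hUi.mono' (by fun_prop) (Eventually.of_forall fun x => ?_)
    rw [Real.norm_of_nonneg (Real.exp_pos _).le]
    refine Real.exp_le_exp.2 ?_
    have : 0 ≤ ε * ‖x‖ ^ q := by positivity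
    simp only [hWdef]; linarith
  set r : ℕ → EuclideanSpace ℝ (Fin n) → ℝ := fun k => regDensity N H (χ k) (δ k) with hr
  have hrpos : ∀ k x, 0 < r k x := fun k => regDensity_pos (hχ0 k) (hδ0 k)
  have hrc : ∀ k, Continuous (r k) := fun k => (contDiff_regDensity hH (hχ k)).continuous
  have hη := integrable_exp_neg_tailPotential hN
  have hVη := integrable_mul_exp_neg_tailPotential hV hq hVc (N := N) (by linarith)
  set A := K * N ^ p with hA
  -- By sublinearity there is one term per piece: `D e^{-H}` for `∇H` against `U`, `c k e^{-H}` for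
  -- `∇χ` against `ε|v|^q`, and `A` for the tail, where `N‖v‖ - ε‖v‖^q ≤ K N^p = A`.
  set M : ℕ → EuclideanSpace ℝ (Fin n) → ℝ := fun k x =>
    D x * Real.exp (-H x) + c k * Real.exp (-H x) + δ k * (A * Real.exp (-tailPotential N x))
    with hM
  have hMi : ∀ k, Integrable (M k) := fun k =>
    (hD.add (hHi.const_mul _)).add ((hη.const_mul _).const_mul _)
  have hMle : ∀ k, ∀ᵐ x, ∀ v, -fderiv ℝ (r k) x v - W v * r k x ≤ M k x := by
    intro k
    filter_upwards [hle] with x hx v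
    have hx0 : 0 ≤ D x := by simpa [hU0] using hx 0
    rw [hr, fderiv_regDensity hH (hχ k)]
    simp only [regDensity, hWdef, hM]
    have e0 := Real.exp_pos (-H x)
    have t1 := mul_le_mul_of_nonneg_left (hx v) (mul_nonneg e0.le (hχ0 k x))
    have t1' : Real.exp (-H x) * χ k x * D x ≤ D x * Real.exp (-H x) := by
      nlinarith [mul_le_mul_of_nonneg_left (hχ1 k x) (mul_nonneg e0.le hx0)]
    have t2 := mul_le_mul_of_nonneg_left (hχle k x v) e0.le
    have t3 : fderiv ℝ (tailPotential N) x v - (U v + ε * ‖v‖ ^ q) ≤ A := by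
      have := (le_abs_self _).trans ((fderiv ℝ (tailPotential N) x).le_opNorm v)
      have := mul_le_mul_of_nonneg_right (norm_fderiv_tailPotential_le hN0 x) (norm_nonneg v)
      have := hK N ‖v‖ hN0 (norm_nonneg v)
      linarith [hUn v]
    have t4 := mul_le_mul_of_nonneg_left t3
      (mul_nonneg (hδ0 k).le (Real.exp_pos (-tailPotential N x)).le)
    linarith
  have key := fun k => integral_regDensity_mul_log_le hε hq1 hWc hW0 hWq hWi hN hH (hχ k) (hχc k)
    (hχ0 k) (hδ0 k) (hMi k) (hMle k)
  -- pointwise convergence and domination of the densities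
  have hrlim : ∀ x, Tendsto (fun k => r k x) atTop (𝓝 (Real.exp (-H x))) := fun x => by
    simpa [hr, regDensity] using ((hχlim x).const_mul (Real.exp (-H x))).add
      (hδ.mul_const (Real.exp (-tailPotential N x)))
  have hrle : ∀ k x, r k x ≤ Real.exp (-H x) + Real.exp (-tailPotential N x) := fun k x => by
    have h1 := mul_le_mul_of_nonneg_left (hχ1 k x) (Real.exp_pos (-H x)).le
    have h2 := mul_le_mul_of_nonneg_right (hδ1 k) (Real.exp_pos (-tailPotential N x)).le
    simp only [hr, regDensity]
    linarith
  have hri : ∀ k, Integrable (r k) := fun k =>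
    (hHi.add hη).mono' (hrc k).aestronglyMeasurable (Eventually.of_forall fun x => by
      rw [Real.norm_of_nonneg (hrpos k x).le]; exact hrle k x)
  have hVb : ∀ k x, ‖V x * r k x‖ ≤ ‖V x * Real.exp (-H x)‖ +
      ‖V x * Real.exp (-tailPotential N x)‖ := fun k x => by
    simp only [norm_mul, Real.norm_of_nonneg (hrpos k x).le,
      Real.norm_of_nonneg (Real.exp_pos _).le]
    rw [← mul_add]
    exact mul_le_mul_of_nonneg_left (hrle k x) (norm_nonneg _)
  have hVri : ∀ k, Integrable fun x => V x * r k x := fun k =>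
    (hVH.norm.add hVη.norm).mono' (hVc.mul (hrc k)).aestronglyMeasurable
      (Eventually.of_forall (hVb k))
  have limZ : Tendsto (fun k => ∫ x, r k x) atTop (𝓝 1) := by
    rw [← hH1]
    exact tendsto_integral_of_dominated_convergence _ (fun k => (hrc k).aestronglyMeasurable)
      (hHi.add hη) (fun k => Eventually.of_forall fun x => by
        rw [Real.norm_of_nonneg (hrpos k x).le]; exact hrle k x) (Eventually.of_forall hrlim)
  have limV : Tendsto (fun k => ∫ x, V x * r k x) atTop (𝓝 (∫ x, V x * Real.exp (-H x))) :=
    tendsto_integral_of_dominated_convergence _ (fun k => (hVc.mul (hrc k)).aestronglyMeasurable)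
      (hVH.norm.add hVη.norm) (fun k => Eventually.of_forall (hVb k))
      (Eventually.of_forall fun x => (hrlim x).const_mul _)
  have limM : Tendsto (fun k => ∫ x, M k x) atTop (𝓝 (∫ x, D x * Real.exp (-H x))) := by
    have e : ∀ k, ∫ x, M k x = (∫ x, D x * Real.exp (-H x)) + c k +
        δ k * ∫ x : EuclideanSpace ℝ (Fin n), A * Real.exp (-tailPotential N x) := fun k => by
      rw [hM]
      simp only
      rw [integral_add_add hD (hHi.const_mul _) ((hη.const_mul _).const_mul _), integral_const_mul, integral_const_mul, hH1, mul_one]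
    simp_rw [e]
    simpa using (hc.const_add (∫ x, D x * Real.exp (-H x))).add (hδ.mul_const _)
  set B := ∫ x, Real.exp (-W x) with hB
  set a : ℕ → ℝ := fun k => ((∫ x, M k x) - (∫ x, r k x) * (n - Real.log (∫ x, r k x) + Real.log B))
    + (∫ x, V x * r k x) + ∫ x, Real.exp (-V x) with hadef
  set a' : ℝ := ((∫ x, D x * Real.exp (-H x)) - 1 * (n - Real.log 1 + Real.log B))
    + (∫ x, V x * Real.exp (-H x)) + ∫ x, Real.exp (-V x) with ha'
  have lima : Tendsto a atTop (𝓝 a') :=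
    ((limM.sub (limZ.mul (((limZ.log one_ne_zero).const_sub (n : ℝ)).add_const _))).add
      limV).add_const _
  set P : ℕ → EuclideanSpace ℝ (Fin n) → ℝ := fun k x =>
    r k x * Real.log (r k x) + V x * r k x + Real.exp (-V x) with hP
  have hP0 : ∀ k x, 0 ≤ P k x := fun k x => mul_log_add_mul_add_exp_neg_nonneg (hrpos k x) _
  have hPi : ∀ k, Integrable (P k) := fun k => ((key k).1.add (hVri k)).add hVi
  have hPa : ∀ k, ∫ x, P k x ≤ a k := fun k => by
    rw [hP]
    simp only
    rw [integral_add_add (key k).1 (hVri k) hVi]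
    have := (key k).2
    simp only [hadef]
    linarith
  have ha0 : 0 ≤ a' := ge_of_tendsto' lima fun k => (integral_nonneg (hP0 k)).trans (hPa k)
  set Q : EuclideanSpace ℝ (Fin n) → ℝ := fun x =>
    -(H x * Real.exp (-H x)) + V x * Real.exp (-H x) + Real.exp (-V x) with hQ
  have hQc : Continuous Q := by fun_prop
  have hQe : ∀ x, Q x = Real.exp (-H x) * Real.log (Real.exp (-H x)) + V x * Real.exp (-H x) +
      Real.exp (-V x) := fun x => by
    rw [Real.log_exp, hQ]; ring
  have hQ0 : ∀ x, 0 ≤ Q x := fun x => by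
    rw [hQe]; exact mul_log_add_mul_add_exp_neg_nonneg (Real.exp_pos _) _
  have hPQ : ∀ x, Tendsto (fun k => P k x) atTop (𝓝 (Q x)) := fun x => by
    rw [hQe]
    exact (((hrlim x).mul ((hrlim x).log (Real.exp_pos _).ne')).add
      ((hrlim x).const_mul _)).add_const _
  -- Fatou's lemma gives both the integrability of `H e^{-H}`, which is not assumed, and the
  -- limiting inequality.
  have hfat : ∫⁻ x, ENNReal.ofReal (Q x) ≤ ENNReal.ofReal a' := by
    calc ∫⁻ x, ENNReal.ofReal (Q x)
        = ∫⁻ x, liminf (fun k => ENNReal.ofReal (P k x)) atTop := by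
          refine lintegral_congr fun x => ?_
          exact ((ENNReal.continuous_ofReal.tendsto _).comp (hPQ x)).liminf_eq.symm
      _ ≤ liminf (fun k => ∫⁻ x, ENNReal.ofReal (P k x)) atTop :=
          lintegral_liminf_le' fun k => (hPi k).1.aemeasurable.ennreal_ofReal
      _ ≤ liminf (fun k => ENNReal.ofReal (a k)) atTop := by
          refine liminf_le_liminf (Eventually.of_forall fun k => ?_)
          rw [← ofReal_integral_eq_lintegral_ofReal (hPi k) (Eventually.of_forall (hP0 k))]
          exact ENNReal.ofReal_le_ofReal (hPa k)
      _ = ENNReal.ofReal a' := ((ENNReal.continuous_ofReal.tendsto _).comp lima).liminf_eq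
  have hQi : Integrable Q := by
    refine ⟨hQc.aestronglyMeasurable, ?_⟩
    rw [hasFiniteIntegral_iff_ofReal (Eventually.of_forall hQ0)]
    exact hfat.trans_lt ENNReal.ofReal_lt_top
  have hQa : ∫ x, Q x ≤ a' := by
    rw [← ofReal_integral_eq_lintegral_ofReal hQi (Eventually.of_forall hQ0)] at hfat
    exact (ENNReal.ofReal_le_ofReal_iff ha0).1 hfat
  have hHint : Integrable fun x => H x * Real.exp (-H x) := by
    have := ((hQi.sub hVi).sub hVH).neg
    refine this.congr (Eventually.of_forall fun x => ?_)
    simp [hQ]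
  refine ⟨hHint, ?_⟩
  have e : ∫ x, Q x = -(∫ x, H x * Real.exp (-H x)) + (∫ x, V x * Real.exp (-H x)) +
      ∫ x, Real.exp (-V x) := by
    rw [hQ]
    simp only
    rw [integral_add_add (f := fun x => -(H x * Real.exp (-H x))) hHint.neg hVH hVi, integral_neg]
  rw [e, ha', Real.log_one] at hQa
  linarith

/-! ### Homogeneity and optimal scaling -/

/-- The open set `{V < 0}` has finite volume, because `e^{-V} ≥ 1` on it. It is invariant under
dilation by `2`, which multiplies volume by `2^n > 1`, so it is empty. -/
theorem IsHomogeneousOfDegree.nonneg {n : ℕ} (hn : 0 < n) {q : ℝ}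
    {V : EuclideanSpace ℝ (Fin n) → ℝ} (hV : IsHomogeneousOfDegree q V) (hc : Continuous V)
    (hi : Integrable fun x => Real.exp (-V x)) (x : EuclideanSpace ℝ (Fin n)) : 0 ≤ V x := by
  by_contra! hx
  set S := {y | V y < 0} with hS
  have hSo : IsOpen S := isOpen_lt hc continuous_const
  have hpos : 0 < volume S := hSo.measure_pos volume ⟨x, hx⟩
  have hfin : volume S < ∞ := by
    refine (measure_mono fun y hy => ?_).trans_lt (hi.measure_norm_ge_lt_top one_pos)
    have hy' : V y < 0 := hy
    simp only [Real.norm_of_nonneg (Real.exp_pos _).le, mem_ofPred_eq]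
    exact Real.one_le_exp (by linarith)
  have hsmul : (2 : ℝ) • S = S := by
    ext y
    rw [mem_smul_set_iff_inv_smul_mem₀ two_ne_zero]
    simp only [hS, mem_ofPred_eq]
    rw [hV _ _ (by norm_num), mul_neg_iff]
    have : (0 : ℝ) < (2 : ℝ)⁻¹ ^ q := by positivity
    constructor
    · rintro (h | h)
      · exact h.2
      · linarith [h.1]
    · exact fun h => Or.inl ⟨this, h⟩
  have h1 := Measure.addHaar_smul volume (2 : ℝ) S
  rw [hsmul, finrank_euclideanSpace_fin, abs_of_pos (by positivity)] at h1
  have h2 : (volume S).toReal = 2 ^ n * (volume S).toReal := by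
    conv_lhs => rw [h1]
    rw [ENNReal.toReal_mul, ENNReal.toReal_ofReal (by positivity)]
  have h3 : 0 < (volume S).toReal := ENNReal.toReal_pos hpos.ne' hfin.ne
  have h4 : (1 : ℝ) < 2 ^ n := one_lt_pow₀ one_lt_two hn.ne'
  nlinarith

theorem integral_exp_neg_mul_of_homogeneous {n : ℕ} {q l : ℝ} {V : EuclideanSpace ℝ (Fin n) → ℝ}
    (hV : IsHomogeneousOfDegree q V) (hq : 0 < q) (hl : 0 < l)
    (hi : Integrable fun x => Real.exp (-V x)) :
    Integrable (fun x => Real.exp (-(l * V x))) ∧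
    Real.log (∫ x, Real.exp (-(l * V x))) = Real.log (∫ x, Real.exp (-V x)) - n / q * Real.log l := by
  have hs : 0 < l ^ q⁻¹ := Real.rpow_pos_of_pos hl _
  have e : ∀ x, l * V x = V (l ^ q⁻¹ • x) := fun x => by
    rw [hV _ _ hs.le, ← Real.rpow_mul hl.le, inv_mul_cancel₀ hq.ne', Real.rpow_one]
  simp_rw [e]
  refine ⟨hi.comp_smul hs.ne', ?_⟩
  rw [Measure.integral_comp_smul volume (fun x => Real.exp (-V x)), finrank_euclideanSpace_fin,
    abs_of_pos (by positivity), smul_eq_mul, Real.log_mul (by positivity) (integral_exp_pos hi).ne',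
    Real.log_inv, Real.log_pow, Real.log_rpow hl]
  ring

/-- Linearised Euclidean logarithmic Sobolev inequality. -/
theorem neg_integral_le_integral_sub_log {n : ℕ} {p q : ℝ} (hpq : p.HolderConjugate q)
    {V U H D : EuclideanSpace ℝ (Fin n) → ℝ}
    (hV : IsHomogeneousOfDegree q V) (hVc : Continuous V)
    (hVi : Integrable fun x => Real.exp (-V x))
    (hUc : Continuous U) (hU0 : U 0 = 0) (hUn : ∀ v, 0 ≤ U v)
    (hUi : Integrable fun x => Real.exp (-U x))
    (hH : ContDiff ℝ 1 H) (hHi : Integrable fun x => Real.exp (-H x))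
    (hH1 : ∫ x, Real.exp (-H x) = 1) (hVH : Integrable fun x => V x * Real.exp (-H x))
    (hD : Integrable fun x => D x * Real.exp (-H x))
    (hle : ∀ᵐ x, ∀ v, fderiv ℝ H x v - U v ≤ D x) :
    Integrable (fun x => H x * Real.exp (-H x)) ∧
    -∫ x, H x * Real.exp (-H x) ≤ (∫ x, D x * Real.exp (-H x)) - n -
      Real.log (∫ x, Real.exp (-U x)) := by
  have key := fun (ε : ℝ) (hε : 0 < ε) => neg_integral_le_of_fderiv_sub_le hpq hε hV hVc hVi hUc
    hU0 hUn hUi hH hHi hH1 hVH hD hle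
  refine ⟨(key 1 one_pos).1, ?_⟩
  have hq := hpq.symm.pos
  have hlim : Tendsto (fun k : ℕ => ∫ x, Real.exp (-(U x + 1 / ((k : ℝ) + 1) * ‖x‖ ^ q))) atTop
      (𝓝 (∫ x, Real.exp (-U x))) := by
    refine tendsto_integral_of_dominated_convergence _ (fun k => ?_) hUi
      (fun k => Eventually.of_forall fun x => ?_) (Eventually.of_forall fun x => ?_)
    · have : Continuous fun x : EuclideanSpace ℝ (Fin n) => ‖x‖ ^ q :=
        continuous_norm.rpow_const fun x => Or.inr hq.le
      fun_prop
    · rw [Real.norm_of_nonneg (Real.exp_pos _).le]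
      refine Real.exp_le_exp.2 ?_
      have : 0 ≤ 1 / ((k : ℝ) + 1) * ‖x‖ ^ q := by positivity
      linarith
    · have h1 := (tendsto_one_div_add_atTop_nhds_zero_nat (𝕜 := ℝ)).mul_const (‖x‖ ^ q)
      have h2 := (Real.continuous_exp.tendsto _).comp (h1.const_add (U x)).neg
      simpa [Function.comp_def] using h2
  exact ge_of_tendsto' ((hlim.log (integral_exp_pos hUi).ne').const_sub _) fun k =>
    (key (1 / ((k : ℝ) + 1)) (by positivity)).2

/-- Sharp Euclidean `L^p` logarithmic Sobolev inequality. -/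
theorem neg_integral_le_log_integral {n : ℕ} (hn : 0 < n) {p q : ℝ} (hpq : p.HolderConjugate q)
    {V H D : EuclideanSpace ℝ (Fin n) → ℝ}
    (hV : IsHomogeneousOfDegree q V) (hVc : Continuous V)
    (hVi : Integrable fun x => Real.exp (-V x))
    (hH : ContDiff ℝ 1 H) (hHi : Integrable fun x => Real.exp (-H x))
    (hH1 : ∫ x, Real.exp (-H x) = 1) (hVH : Integrable fun x => V x * Real.exp (-H x))
    (hD : Integrable fun x => D x * Real.exp (-H x))
    (hle : ∀ᵐ x, ∀ v, fderiv ℝ H x v - V v ≤ D x) (hA : 0 < ∫ x, D x * Real.exp (-H x)) :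
    Integrable (fun x => H x * Real.exp (-H x)) ∧
    -∫ x, H x * Real.exp (-H x) ≤ n / p * Real.log (p / n * ∫ x, D x * Real.exp (-H x)) +
      n * ((1 - p) / p) - Real.log (∫ x, Real.exp (-V x)) := by
  have hq := hpq.symm.pos
  have hp := hpq.pos
  have hp1 : 0 < p - 1 := by linarith [hpq.lt]
  have hn' : (0 : ℝ) < n := by exact_mod_cast hn
  set A := ∫ x, D x * Real.exp (-H x) with hAdef
  have hconj : (p - 1) * (q - 1) = 1 := by
    have := hpq.sub_one_mul_conj
    nlinarith
  set T := p / n * A with hT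
  have hT0 : 0 < T := by positivity
  -- The minimiser of `l^{1-p} A + (n/q) log l`, since `q (p - 1) = p`.
  set l := T ^ (p - 1)⁻¹ with hl
  have hl0 : 0 < l := Real.rpow_pos_of_pos hT0 _
  set c := l ^ (1 - p) with hc
  have hc0 : 0 < c := Real.rpow_pos_of_pos hl0 _
  have hcT : c = T⁻¹ := by
    rw [hc, hl, ← neg_sub p 1, Real.rpow_neg (Real.rpow_pos_of_pos hT0 _).le, ← Real.rpow_mul hT0.le,
      inv_mul_cancel₀ hp1.ne', Real.rpow_one]
  have hVn := hV.nonneg hn hVc hVi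
  obtain ⟨hUi, hUl⟩ := integral_exp_neg_mul_of_homogeneous hV hq hl0 hVi
  have hD' : (fun x => c * D x * Real.exp (-H x)) = fun x => c * (D x * Real.exp (-H x)) := by
    funext x; ring
  obtain ⟨h1, h2⟩ := neg_integral_le_integral_sub_log hpq hV hVc hVi (U := fun x => l * V x)
    (D := fun x => c * D x) (hVc.const_mul l) (by simp [hV.apply_zero hq])
    (fun v => mul_nonneg hl0.le (hVn v)) hUi hH hHi hH1 hVH (by rw [hD']; exact hD.const_mul c)
    (by
      filter_upwards [hle] with x hx v
      have h := mul_le_mul_of_nonneg_left (hx (c⁻¹ • v)) hc0.le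
      -- This is `(l V)* = c V*` in disguise: `c^{1-q} = l^{(1-p)(1-q)} = l`.
      have e : c * V (c⁻¹ • v) = l * V v := by
        rw [hV _ _ (inv_pos.2 hc0).le, ← mul_assoc]
        congr 1
        rw [Real.inv_rpow hc0.le, ← Real.rpow_neg hc0.le]
        nth_rewrite 1 [← Real.rpow_one c]
        rw [← Real.rpow_add hc0, hc, ← Real.rpow_mul hl0.le]
        have : (1 - p) * (1 + -q) = 1 := by linarith
        rw [this, Real.rpow_one]
      rw [mul_sub, e, map_smul, smul_eq_mul, mul_inv_cancel_left₀ hc0.ne'] at h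
      exact h)
  refine ⟨h1, h2.trans (le_of_eq ?_)⟩
  rw [hD', integral_const_mul, hUl, hcT, ← hAdef, hl, Real.log_rpow hT0]
  have e1 : T⁻¹ * A = n / p := by rw [hT]; field_simp
  have e2 : n / q * ((p - 1)⁻¹ * Real.log T) = n / p * Real.log T := by
    have : q * (p - 1) = p := by
      have := hpq.sub_one_mul_conj
      linarith
    rw [← mul_assoc, ← div_eq_mul_inv, div_div, this]
  rw [e1, e2]
  field_simp
  ring

/-! ### Extended-valued integrals, logarithm and entropy -/

section Ext

variable {α : Type*} [MeasurableSpace α] {μ : Measure α}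

theorem extIntegral_of_nonneg {g : α → EReal} (hg : ∀ x, 0 ≤ g x) :
    extIntegral μ g = ((∫⁻ x, (g x).toENNReal ∂μ : ℝ≥0∞) : EReal) := by
  have : ∀ x, (-g x).toENNReal = 0 := fun x =>
    EReal.toENNReal_of_nonpos (EReal.neg_le_zero.2 (hg x))
  simp [extIntegral, this]

theorem extIntegral_coe {u : α → ℝ} (hu : Integrable u μ) :
    extIntegral μ (fun x => (u x : EReal)) = ((∫ x, u x ∂μ : ℝ) : EReal) := by
  have h1 : ∫⁻ x, ENNReal.ofReal (u x) ∂μ ≠ ∞ := hu.lintegral_lt_top.ne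
  have h2 : ∫⁻ x, ENNReal.ofReal (-u x) ∂μ ≠ ∞ := hu.neg.lintegral_lt_top.ne
  rw [integral_eq_lintegral_pos_part_sub_lintegral_neg_part hu, EReal.coe_sub,
    EReal.coe_ennreal_toReal h1, EReal.coe_ennreal_toReal h2]
  rfl

theorem extLog_coe {x : ℝ} (hx : 0 < x) : extLog (x : EReal) = (Real.log x : EReal) := by
  rw [extLog, EReal.real_coe_toENNReal, ENNReal.log_ofReal_of_pos hx]

theorem extLog_top : extLog ⊤ = ⊤ := by simp [extLog]

theorem entropy_exp {f : α → ℝ} (h1 : ∫ x, Real.exp (f x) ∂μ = 1)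
    (hf : Integrable (fun x => Real.exp (f x) * f x) μ) :
    entropy μ (fun x => Real.exp (f x)) = ((∫ x, Real.exp (f x) * f x ∂μ : ℝ) : EReal) := by
  simp only [entropy, h1, Real.log_exp, Real.log_one, mul_zero, EReal.coe_zero, sub_zero]
  exact extIntegral_coe hf

end Ext

/-! ### Gibbs measures and the Legendre transform -/

section Gibbs

variable {n : ℕ} {V : EuclideanSpace ℝ (Fin n) → ℝ}

theorem measurable_gibbsDensity (hV : Continuous V) : Measurable fun x =>
    ENNReal.ofReal (Real.exp (-V x - Real.log (∫ y, Real.exp (-V y)))) := by fun_prop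

theorem integrable_gibbsMeasure_iff (hV : Continuous V) {u : EuclideanSpace ℝ (Fin n) → ℝ} :
    Integrable u (gibbsMeasure V) ↔
      Integrable fun x => u x * Real.exp (-V x - Real.log (∫ y, Real.exp (-V y))) := by
  rw [gibbsMeasure, integrable_withDensity_iff (measurable_gibbsDensity hV)
    (Eventually.of_forall fun x => ENNReal.ofReal_lt_top)]
  simp only [ENNReal.toReal_ofReal (Real.exp_pos _).le]

theorem integral_gibbsMeasure (hV : Continuous V) (u : EuclideanSpace ℝ (Fin n) → ℝ) :
    ∫ x, u x ∂(gibbsMeasure V) =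
      ∫ x, u x * Real.exp (-V x - Real.log (∫ y, Real.exp (-V y))) := by
  rw [gibbsMeasure, integral_withDensity_eq_integral_toReal_smul (measurable_gibbsDensity hV)
    (Eventually.of_forall fun x => ENNReal.ofReal_lt_top)]
  simp only [ENNReal.toReal_ofReal (Real.exp_pos _).le, smul_eq_mul, mul_comm]

theorem lintegral_gibbsMeasure (hV : Continuous V) {g : EuclideanSpace ℝ (Fin n) → ℝ≥0∞}
    (hg : Measurable g) : ∫⁻ x, g x ∂(gibbsMeasure V) =
      ∫⁻ x, g x * ENNReal.ofReal (Real.exp (-V x - Real.log (∫ y, Real.exp (-V y)))) := by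
  rw [gibbsMeasure, lintegral_withDensity_eq_lintegral_mul _ (measurable_gibbsDensity hV) hg]
  simp [mul_comm]

theorem legendreTransform_nonneg (hV0 : V 0 = 0) (x : EuclideanSpace ℝ (Fin n)) :
    0 ≤ legendreTransform V x := by
  refine le_trans ?_ (le_iSup (fun y => ((⟪x, y⟫ - V y : ℝ) : EReal)) 0)
  simp [hV0]

theorem measurable_legendreTransform_comp {g : EuclideanSpace ℝ (Fin n) → EuclideanSpace ℝ (Fin n)}
    (hg : Continuous g) : Measurable fun x => legendreTransform V (g x) := by
  refine LowerSemicontinuous.measurable ?_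
  refine lowerSemicontinuous_iSup fun y => Continuous.lowerSemicontinuous ?_
  exact continuous_coe_real_ereal.comp ((hg.inner continuous_const).sub continuous_const)

theorem continuous_gradient {h : EuclideanSpace ℝ (Fin n) → ℝ} (hh : ContDiff ℝ 1 h) :
    Continuous (gradient h) :=
  (LinearIsometryEquiv.continuous _).comp (hh.continuous_fderiv one_ne_zero)

theorem inner_gradient {h : EuclideanSpace ℝ (Fin n) → ℝ} (x v : EuclideanSpace ℝ (Fin n)) :
    ⟪gradient h x, v⟫ = fderiv ℝ h x v := by
  rw [gradient, InnerProductSpace.toDual_symm_apply]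

/-- Here `⟪w, y⟫ ≤ V y` for all `y`. Along `y = t w` the left side is linear in `t` and the right
side is of order `t^q` with `q > 1`; let `t → 0`. -/
theorem eq_zero_of_legendreTransform_nonpos {q : ℝ} (hq : 1 < q) (hV : IsHomogeneousOfDegree q V)
    {w : EuclideanSpace ℝ (Fin n)} (hw : legendreTransform V w ≤ 0) : w = 0 := by
  have h1 : ∀ y, ⟪w, y⟫ ≤ V y := fun y => by
    have := (le_iSup (fun y => ((⟪w, y⟫ - V y : ℝ) : EReal)) y).trans hw
    have : ⟪w, y⟫ - V y ≤ 0 := by exact_mod_cast this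
    linarith
  have h2 : ∀ᶠ t : ℝ in 𝓝[>] 0, ⟪w, w⟫ ≤ t ^ (q - 1) * V w := by
    filter_upwards [self_mem_nhdsWithin] with t ht
    have ht' : (0 : ℝ) < t := ht
    have := h1 (t • w)
    rw [hV t w ht'.le, inner_smul_right] at this
    rw [Real.rpow_sub_one ht'.ne', div_mul_eq_mul_div, le_div_iff₀ ht']
    linarith
  have h3 : Tendsto (fun t : ℝ => t ^ (q - 1) * V w) (𝓝[>] 0) (𝓝 0) := by
    have : Tendsto (fun t : ℝ => t ^ (q - 1) * V w) (𝓝 0) (𝓝 (0 ^ (q - 1) * V w)) :=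
      (((Real.continuous_rpow_const (by linarith)).tendsto 0)).mul_const _
    rw [Real.zero_rpow (by linarith), zero_mul] at this
    exact this.mono_left nhdsWithin_le_nhds
  have h4 := ge_of_tendsto h3 h2
  rw [real_inner_self_eq_norm_sq] at h4
  have : ‖w‖ = 0 := by nlinarith [norm_nonneg w]
  exact norm_eq_zero.1 this

/-- Such an `h` is constant and the space has infinite volume. This excludes a vanishing Legendre
integral, hence the value `log 0 = -∞`. -/
theorem not_integrable_exp_neg_of_gradient_eq_zero (hn : 0 < n) {h : EuclideanSpace ℝ (Fin n) → ℝ}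
    (hh : ContDiff ℝ 1 h) (h0 : ∀ᵐ x, gradient h x = 0) :
    ¬ Integrable fun x => Real.exp (-h x) := by
  intro hi
  have : Nonempty (Fin n) := ⟨⟨0, hn⟩⟩
  have h1 : gradient h = fun _ => 0 :=
    (Continuous.ae_eq_iff_eq volume (continuous_gradient hh) continuous_const).1 h0
  have h2 : ∀ x, fderiv ℝ h x = 0 := fun x => by
    ext v
    rw [← inner_gradient, h1]
    simp
  have h3 : (fun x => Real.exp (-h x)) = fun _ => Real.exp (-h 0) := by
    funext x
    rw [is_const_of_fderiv_eq_zero (hh.differentiable one_ne_zero) h2 x 0]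
  rw [h3, integrable_const_iff] at hi
  rcases hi with hi | hi
  · exact (Real.exp_pos _).ne' hi
  · have := hi.measure_univ_lt_top
    rw [measure_univ_of_isAddLeftInvariant] at this
    exact lt_irrefl _ this

end Gibbs

/-! ### The dimensional inequality for Gibbs measures -/

/-- The dimensional `L^p` logarithmic Sobolev inequality. -/
theorem entropy_gibbsMeasure_le {n : ℕ} (hn : 0 < n) {p q : ℝ} (hpq : p.HolderConjugate q)
    {V f : EuclideanSpace ℝ (Fin n) → ℝ} (hVC : ContDiff ℝ 1 V) (hV : IsHomogeneousOfDegree q V)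
    (hVi : Integrable (fun x => Real.exp (-V x))) (hf : ContDiff ℝ 1 f)
    (hf1 : ∫ x, Real.exp (f x) ∂(gibbsMeasure V) = 1) :
    entropy (gibbsMeasure V) (fun x => Real.exp (f x)) ≤
      (((n : ℝ) / p : ℝ) : EReal) *
          extLog (((p / (n : ℝ) : ℝ) : EReal) *
            extIntegral (gibbsMeasure V) (fun x =>
              legendreTransform V (gradient (fun y => V y - f y) x) *
                ((Real.exp (f x) : ℝ) : EReal)))
        + (((n : ℝ) * ((1 - p) / p) : ℝ) : EReal)
        + extIntegral (gibbsMeasure V) (fun x => ((V x * Real.exp (f x) : ℝ) : EReal)) := by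
  have hn' : (0 : ℝ) < n := by exact_mod_cast hn
  have hp := hpq.pos
  have hq := hpq.symm.pos
  have hVc := hVC.continuous
  have hfc := hf.continuous
  have hVn := hV.nonneg hn hVc hVi
  set β := Real.log (∫ y, Real.exp (-V y)) with hβ
  set h : EuclideanSpace ℝ (Fin n) → ℝ := fun y => V y - f y with hh
  have hhC : ContDiff ℝ 1 h := hVC.sub hf
  set H : EuclideanSpace ℝ (Fin n) → ℝ := fun y => h y + β with hH
  have hHC : ContDiff ℝ 1 H := hhC.add contDiff_const
  have hHc := hHC.continuous
  have hexp : ∀ x, Real.exp (f x) * Real.exp (-V x - β) = Real.exp (-H x) := fun x => by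
    rw [← Real.exp_add]; congr 1; simp only [hH, hh]; ring
  -- The Bochner integral of a non-integrable function is `0`, so the value `1` forces
  -- integrability.
  have hfi : Integrable (fun x => Real.exp (f x)) (gibbsMeasure V) := by
    by_contra hc
    rw [integral_undef hc] at hf1
    exact zero_ne_one hf1
  have hHi : Integrable fun x => Real.exp (-H x) := by
    have := (integrable_gibbsMeasure_iff hVc).1 hfi
    simpa only [← hβ, hexp] using this
  have hH1 : ∫ x, Real.exp (-H x) = 1 := by
    rw [integral_gibbsMeasure hVc, ← hβ] at hf1
    simpa only [hexp] using hf1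
  have hfd : ∀ x v, fderiv ℝ H x v = ⟪gradient h x, v⟫ := fun x v => by
    rw [inner_gradient, hH, fderiv_add_const]
  set Λ : EuclideanSpace ℝ (Fin n) → EReal := fun x => legendreTransform V (gradient h x) with hΛ
  have hΛ0 : ∀ x, 0 ≤ Λ x := fun x => legendreTransform_nonneg (hV.apply_zero hq) _
  have hΛm : Measurable Λ := measurable_legendreTransform_comp (continuous_gradient hhC)
  set J : ℝ≥0∞ := ∫⁻ x, (Λ x).toENNReal * ENNReal.ofReal (Real.exp (-H x)) with hJ
  have hJe : extIntegral (gibbsMeasure V) (fun x => Λ x * ((Real.exp (f x) : ℝ) : EReal)) = J := by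
    rw [extIntegral_of_nonneg fun x => mul_nonneg (hΛ0 x) (by exact_mod_cast (Real.exp_pos _).le)]
    simp only [EReal.toENNReal_mul (hΛ0 _), EReal.real_coe_toENNReal]
    rw [lintegral_gibbsMeasure hVc (by fun_prop), ← hβ]
    simp only [mul_assoc, ← ENNReal.ofReal_mul (Real.exp_pos _).le, hexp]
    rfl
  set S : ℝ≥0∞ := ∫⁻ x, ENNReal.ofReal (V x * Real.exp (-H x)) with hS
  have hSe : extIntegral (gibbsMeasure V) (fun x => ((V x * Real.exp (f x) : ℝ) : EReal)) = S := by
    rw [extIntegral_of_nonneg fun x => by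
      exact_mod_cast mul_nonneg (hVn x) (Real.exp_pos _).le]
    simp only [EReal.real_coe_toENNReal]
    rw [lintegral_gibbsMeasure hVc (by fun_prop), ← hβ]
    simp only [← ENNReal.ofReal_mul (mul_nonneg (hVn _) (Real.exp_pos _).le), mul_assoc, hexp]
    rfl
  rw [hJe, hSe]
  have hnp : (0 : EReal) < ((n / p : ℝ) : EReal) := by exact_mod_cast div_pos hn' hp
  have hpn : (0 : EReal) < ((p / n : ℝ) : EReal) := by exact_mod_cast div_pos hp hn'
  have hJm : Measurable fun x => (Λ x).toENNReal * ENNReal.ofReal (Real.exp (-H x)) := by fun_prop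
  have hJ0 : J ≠ 0 := by
    intro h0
    refine not_integrable_exp_neg_of_gradient_eq_zero hn hHC ?_ hHi
    filter_upwards [(lintegral_eq_zero_iff hJm).1 h0] with x hx
    have h1 : (Λ x).toENNReal = 0 := by
      simpa [(Real.exp_pos _).not_ge] using hx
    have e : gradient H x = gradient h x := by
      refine ext_inner_right ℝ fun v => ?_
      rw [inner_gradient, hfd]
    rw [e]
    exact eq_zero_of_legendreTransform_nonpos hpq.symm.lt hV (EReal.toENNReal_eq_zero_iff.1 h1)
  have hS0 : (0 : EReal) ≤ (S : EReal) := EReal.coe_ennreal_nonneg _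
  have hSbot : (S : EReal) ≠ ⊥ := fun hb => by rw [hb] at hS0; exact absurd hS0 (by simp)
  -- If `J` or `S` is infinite the right side is `+∞`: as `J ≠ 0` and `S ≥ 0`, no `-∞` can enter the
  -- sum.
  by_cases hJt : J = ⊤
  · rw [hJt, EReal.coe_ennreal_top, EReal.mul_top_of_pos hpn, extLog_top, EReal.mul_top_of_pos hnp,
      EReal.top_add_coe, EReal.top_add_of_ne_bot hSbot]
    exact le_top
  set A := J.toReal with hA
  have hA0 : 0 < A := ENNReal.toReal_pos hJ0 hJt
  have hJA : (J : EReal) = (A : EReal) := (EReal.coe_ennreal_toReal hJt).symm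
  rw [hJA, ← EReal.coe_mul, extLog_coe (by positivity), ← EReal.coe_mul, ← EReal.coe_add]
  by_cases hSt : S = ⊤
  · rw [hSt, EReal.coe_ennreal_top, EReal.coe_add_top]
    exact le_top
  have hVH : Integrable fun x => V x * Real.exp (-H x) := by
    refine ⟨by fun_prop, ?_⟩
    rw [hasFiniteIntegral_iff_ofReal
      (Eventually.of_forall fun x => mul_nonneg (hVn x) (Real.exp_pos _).le)]
    exact lt_top_iff_ne_top.2 hSt
  have hSS : (S : EReal) = ((∫ x, V x * Real.exp (-H x) : ℝ) : EReal) := by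
    rw [integral_eq_lintegral_of_nonneg_ae
      (Eventually.of_forall fun x => mul_nonneg (hVn x) (Real.exp_pos _).le) hVH.1]
    exact (EReal.coe_ennreal_toReal hSt).symm
  -- the Legendre term is finite almost everywhere
  have hfin : ∀ᵐ x, Λ x ≠ ⊤ := by
    filter_upwards [ae_lt_top hJm hJt] with x hx ht
    rw [ht, EReal.toENNReal_top, ENNReal.top_mul (by simp [Real.exp_pos])] at hx
    exact lt_irrefl _ hx
  set D : EuclideanSpace ℝ (Fin n) → ℝ := fun x => (Λ x).toReal with hD
  have hD0 : ∀ x, 0 ≤ D x * Real.exp (-H x) := fun x =>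
    mul_nonneg (EReal.toReal_nonneg (hΛ0 x)) (Real.exp_pos _).le
  have hDm : Measurable fun x => D x * Real.exp (-H x) :=
    hΛm.ereal_toReal.mul (by fun_prop)
  have hDJ : ∫⁻ x, ENNReal.ofReal (D x * Real.exp (-H x)) = J := by
    refine lintegral_congr_ae ?_
    filter_upwards [hfin] with x hx
    rw [ENNReal.ofReal_mul (EReal.toReal_nonneg (hΛ0 x)), EReal.toENNReal_of_ne_top hx]
  have hDi : Integrable fun x => D x * Real.exp (-H x) := by
    refine ⟨hDm.aestronglyMeasurable, ?_⟩
    rw [hasFiniteIntegral_iff_ofReal (Eventually.of_forall hD0), hDJ]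
    exact lt_top_iff_ne_top.2 hJt
  have hDA : ∫ x, D x * Real.exp (-H x) = A := by
    rw [integral_eq_lintegral_of_nonneg_ae (Eventually.of_forall hD0) hDi.1, hDJ]
  have hle : ∀ᵐ x, ∀ v, fderiv ℝ H x v - V v ≤ D x := by
    filter_upwards [hfin] with x hx v
    have h1 := le_iSup (fun y => ((⟪gradient h x, y⟫ - V y : ℝ) : EReal)) v
    have h2 : Λ x = ((D x : ℝ) : EReal) := (EReal.coe_toReal hx
      (fun hb => by have := hΛ0 x; rw [hb] at this; exact absurd this (by simp))).symm
    rw [hfd]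
    exact_mod_cast h1.trans_eq h2
  obtain ⟨hHint, hmain⟩ := neg_integral_le_log_integral hn hpq hV hVc hVi hHC hHi hH1 hVH hDi hle
    (hDA.symm ▸ hA0)
  have hent : ∀ x, Real.exp (f x) * f x * Real.exp (-V x - β) =
      V x * Real.exp (-H x) + -(H x * Real.exp (-H x)) + β * Real.exp (-H x) := fun x => by
    rw [mul_right_comm, hexp]
    have : f x = V x - H x + β := by simp only [hH, hh]; ring
    rw [this]; ring
  have hfe : Integrable (fun x => Real.exp (f x) * f x) (gibbsMeasure V) := by
    rw [integrable_gibbsMeasure_iff hVc, ← hβ]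
    simp only [hent]
    exact (hVH.add hHint.neg).add (hHi.const_mul β)
  rw [entropy_exp hf1 hfe, hSS, ← EReal.coe_add, EReal.coe_le_coe_iff, integral_gibbsMeasure hVc,
    ← hβ]
  simp only [hent]
  rw [integral_add_add hVH (g := fun x => -(H x * Real.exp (-H x))) hHint.neg (hHi.const_mul β),
    integral_neg, integral_const_mul, hH1]
  rw [hDA, ← hβ] at hmain
  linarith

/-! ### The Gaussian case -/

section Gaussian

variable {n : ℕ}

theorem integrable_exp_neg_norm_sq_div_two :
    Integrable fun x : EuclideanSpace ℝ (Fin n) => Real.exp (-(‖x‖ ^ 2 / 2)) := by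
  have h := (GaussianFourier.integrable_cexp_neg_mul_sq_norm_add (b := 1 / 2) (by norm_num) 0
    (0 : EuclideanSpace ℝ (Fin n))).norm
  refine h.congr (Eventually.of_forall fun x => ?_)
  simp only [Complex.norm_exp]
  congr 1
  rw [zero_mul, add_zero, show (-(1 / 2 : ℂ) * (‖x‖ : ℂ) ^ 2) = ((-(‖x‖ ^ 2 / 2) : ℝ) : ℂ) by
    push_cast; ring, Complex.ofReal_re]

/-- Two finite measures with the same characteristic function coincide; the Gaussian Fourier
integral supplies it, and its value at zero the normalisation. -/
theorem gibbsMeasure_norm_sq_div_two :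
    gibbsMeasure (fun x : EuclideanSpace ℝ (Fin n) => ‖x‖ ^ 2 / 2) =
      ProbabilityTheory.stdGaussian (EuclideanSpace ℝ (Fin n)) := by
  have hi := integrable_exp_neg_norm_sq_div_two (n := n)
  have hc : Continuous fun x : EuclideanSpace ℝ (Fin n) => ‖x‖ ^ 2 / 2 := by fun_prop
  set C := ∫ x : EuclideanSpace ℝ (Fin n), Real.exp (-(‖x‖ ^ 2 / 2)) with hC
  have hC0 : 0 < C := integral_exp_pos hi
  have hdens : ∀ x : EuclideanSpace ℝ (Fin n),
      Real.exp (-(‖x‖ ^ 2 / 2) - Real.log C) = C⁻¹ * Real.exp (-(‖x‖ ^ 2 / 2)) := fun x => by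
    rw [Real.exp_sub, Real.exp_log hC0, div_eq_inv_mul]
  have : IsFiniteMeasure (gibbsMeasure fun x : EuclideanSpace ℝ (Fin n) => ‖x‖ ^ 2 / 2) := by
    refine isFiniteMeasure_withDensity_ofReal ?_
    rw [← hC]
    simp only [hdens]
    exact (hi.const_mul _).2
  refine Measure.ext_of_charFun (funext fun t => ?_)
  have hG := GaussianFourier.integral_cexp_neg_mul_sq_norm_add (b := 1 / 2) (by norm_num)
    Complex.I t
  have hG0 := GaussianFourier.integral_cexp_neg_mul_sq_norm (V := EuclideanSpace ℝ (Fin n))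
    (b := 1 / 2) (by norm_num)
  have hCc : (C : ℂ) = ∫ x : EuclideanSpace ℝ (Fin n), Complex.exp (-(1 / 2) * ‖x‖ ^ 2) := by
    rw [hC, ← integral_complex_ofReal]
    refine integral_congr_ae (Eventually.of_forall fun x => ?_)
    push_cast
    congr 1; ring
  rw [ProbabilityTheory.charFun_stdGaussian, charFun_apply, gibbsMeasure,
    integral_withDensity_eq_integral_toReal_smul (measurable_gibbsDensity hc)
    (Eventually.of_forall fun x => ENNReal.ofReal_lt_top)]
  simp only [ENNReal.toReal_ofReal (Real.exp_pos _).le]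
  rw [← hC]
  have e : ∀ x : EuclideanSpace ℝ (Fin n), Real.exp (-(‖x‖ ^ 2 / 2) - Real.log C) •
      Complex.exp (⟪x, t⟫ * Complex.I) =
      (C : ℂ)⁻¹ * Complex.exp (-(1 / 2) * ‖x‖ ^ 2 + Complex.I * ⟪t, x⟫) := fun x => by
    rw [hdens, Complex.real_smul, Complex.exp_add, real_inner_comm x t]
    push_cast
    rw [mul_assoc, mul_comm (Complex.I)]
    congr 3
    ring
  simp only [e]
  rw [integral_const_mul, hG, hCc, hG0, ← mul_assoc, inv_mul_cancel₀, one_mul]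
  · congr 1
    rw [Complex.I_sq]; ring
  · rw [← hG0, ← hCc]
    exact_mod_cast hC0.ne'

theorem gradient_norm_sq_div_two_sub {f : EuclideanSpace ℝ (Fin n) → ℝ} (hf : ContDiff ℝ 1 f)
    (x : EuclideanSpace ℝ (Fin n)) :
    gradient (fun y => ‖y‖ ^ 2 / 2 - f y) x = x - gradient f x := by
  refine ext_inner_right ℝ fun v => ?_
  have h1 : HasFDerivAt (fun y : EuclideanSpace ℝ (Fin n) => ‖y‖ ^ 2) (2 • innerSL ℝ x) x :=
    (hasStrictFDerivAt_norm_sq x).hasFDerivAt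
  have h2 := (h1.mul_const (1 / 2)).sub (hf.differentiable one_ne_zero x).hasFDerivAt
  have h3 : fderiv ℝ (fun y => ‖y‖ ^ 2 / 2 - f y) x = _ :=
    (h2.congr_of_eventuallyEq (Eventually.of_forall fun y => by simp; ring)).fderiv
  rw [inner_gradient, inner_sub_left, inner_gradient, h3]
  simp

theorem legendreTransform_norm_sq_div_two (y : EuclideanSpace ℝ (Fin n)) :
    legendreTransform (fun x => ‖x‖ ^ 2 / 2) y = ((‖y‖ ^ 2 / 2 : ℝ) : EReal) := by
  refine le_antisymm (iSup_le fun x => ?_) ?_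
  · rw [EReal.coe_le_coe_iff]
    have := norm_sub_sq_real y x
    nlinarith [sq_nonneg ‖y - x‖]
  · refine le_trans (le_of_eq ?_) (le_iSup (fun x => ((⟪y, x⟫ - ‖x‖ ^ 2 / 2 : ℝ) : EReal)) y)
    rw [real_inner_self_eq_norm_sq]
    congr 1; ring

/-- Integration by parts against the identity vector field. -/
theorem integral_inner_gradient_mul_exp_neg {h : EuclideanSpace ℝ (Fin n) → ℝ}
    (hh : ContDiff ℝ 1 h) (hi : Integrable fun x => Real.exp (-h x))
    (h2 : Integrable fun x => ‖x‖ ^ 2 * Real.exp (-h x))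
    (hg : Integrable fun x => ‖gradient h x‖ ^ 2 * Real.exp (-h x)) :
    Integrable (fun x => ⟪x, gradient h x⟫ * Real.exp (-h x)) ∧
    ∫ x, ⟪x, gradient h x⟫ * Real.exp (-h x) = n * ∫ x, Real.exp (-h x) := by
  have hhc := hh.continuous
  have hgc := continuous_gradient hh
  let e : Fin n → EuclideanSpace ℝ (Fin n) := fun i => EuclideanSpace.single i 1
  have hfd : ∀ i x, fderiv ℝ h x (e i) = gradient h x i := fun i x => by
    rw [← inner_gradient, EuclideanSpace.inner_single_right]
    simp
  have hb : ∀ i (x : EuclideanSpace ℝ (Fin n)), |x i| ≤ ‖x‖ := fun i x => by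
    simpa using PiLp.norm_apply_le x i
  have hxi : ∀ i, Continuous fun x : EuclideanSpace ℝ (Fin n) => x i := fun i => by fun_prop
  have i1 : ∀ i, Integrable fun x => x i * Real.exp (-h x) := fun i => by
    refine (hi.add h2).mono' (by fun_prop) (Eventually.of_forall fun x => ?_)
    rw [norm_mul, Real.norm_eq_abs, Real.norm_of_nonneg (Real.exp_pos _).le, Pi.add_apply,
      ← one_add_mul]
    have : |x i| ≤ 1 + ‖x‖ ^ 2 := (hb i x).trans (by nlinarith [sq_nonneg (‖x‖ - 1), norm_nonneg x])
    exact mul_le_mul_of_nonneg_right this (Real.exp_pos _).le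
  have i2 : ∀ i, Integrable fun x => x i * gradient h x i * Real.exp (-h x) := fun i => by
    have hc1 : Continuous fun x => gradient h x i := (hxi i).comp hgc
    refine (h2.add hg).mono' (by fun_prop) (Eventually.of_forall fun x => ?_)
    rw [norm_mul, Real.norm_eq_abs, Real.norm_of_nonneg (Real.exp_pos _).le, Pi.add_apply,
      ← add_mul, abs_mul]
    have a1 := hb i x
    have a2 := hb i (gradient h x)
    have : |x i| * |gradient h x i| ≤ ‖x‖ * ‖gradient h x‖ := by gcongr
    have : |x i| * |gradient h x i| ≤ ‖x‖ ^ 2 + ‖gradient h x‖ ^ 2 := by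
      nlinarith [sq_nonneg (‖x‖ - ‖gradient h x‖), sq_nonneg (‖x‖ + ‖gradient h x‖)]
    exact mul_le_mul_of_nonneg_right this (Real.exp_pos _).le
  -- Integrability of `e^{-h}`, `x_i e^{-h}` and `x_i ∂_i h e^{-h}` ensures that no boundary term
  -- appears.
  have ibp : ∀ i, ∫ x, x i * gradient h x i * Real.exp (-h x) = ∫ x, Real.exp (-h x) := by
    intro i
    have d1 : ∀ x, fderiv ℝ (fun x : EuclideanSpace ℝ (Fin n) => x i) x (e i) = 1 := fun x => by
      have : HasFDerivAt (fun x : EuclideanSpace ℝ (Fin n) => x i)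
          (EuclideanSpace.proj i : EuclideanSpace ℝ (Fin n) →L[ℝ] ℝ) x :=
        (EuclideanSpace.proj i : EuclideanSpace ℝ (Fin n) →L[ℝ] ℝ).hasFDerivAt
      rw [this.fderiv]
      simp [e]
    have d2 : ∀ x, fderiv ℝ (fun x => Real.exp (-h x)) x (e i) =
        -(gradient h x i * Real.exp (-h x)) := fun x => by
      have h3 : fderiv ℝ (fun x => Real.exp (-h x)) x = _ :=
        ((hh.differentiable one_ne_zero x).hasFDerivAt.neg.exp).fderiv
      rw [h3, ← hfd]
      simp
      ring
    have e2 : ∀ x, x i * fderiv ℝ (fun x => Real.exp (-h x)) x (e i) =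
        -(x i * gradient h x i * Real.exp (-h x)) := fun x => by rw [d2]; ring
    have key := integral_mul_fderiv_eq_neg_fderiv_mul_of_integrable (μ := volume) (𝕜 := ℝ)
      (f := fun x : EuclideanSpace ℝ (Fin n) => x i) (g := fun x => Real.exp (-h x)) (v := e i)
      (by simpa only [d1, one_mul] using hi) (by simp only [e2]; exact (i2 i).neg) (i1 i)
      (fun x _ => (EuclideanSpace.proj i : EuclideanSpace ℝ (Fin n) →L[ℝ] ℝ).differentiableAt)
      (fun x _ => (hh.neg.exp.differentiable one_ne_zero) x)
    simp only [e2, d1, one_mul, integral_neg] at key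
    linarith
  have hs : ∀ x, ⟪x, gradient h x⟫ * Real.exp (-h x) =
      ∑ i, x i * gradient h x i * Real.exp (-h x) := fun x => by
    rw [← Finset.sum_mul, PiLp.inner_apply]
    simp [mul_comm]
  simp only [hs]
  refine ⟨integrable_finsetSum _ fun i _ => i2 i, ?_⟩
  rw [integral_finsetSum _ fun i _ => i2 i]
  simp [ibp]

theorem isHomogeneousOfDegree_norm_sq_div_two :
    IsHomogeneousOfDegree 2 fun x : EuclideanSpace ℝ (Fin n) => ‖x‖ ^ 2 / 2 := by
  intro t x ht
  simp only [norm_smul, Real.norm_of_nonneg ht, Real.rpow_two]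
  ring

/-- The Bakry–Ledoux dimensional logarithmic Sobolev inequality. -/
theorem entropy_gaussian_le (hn : 0 < n) {f : EuclideanSpace ℝ (Fin n) → ℝ} (hf : ContDiff ℝ 1 f)
    {γ : Measure (EuclideanSpace ℝ (Fin n))} (hγ : gibbsMeasure (fun x => ‖x‖ ^ 2 / 2) = γ)
    (hf1 : ∫ x, Real.exp (f x) ∂γ = 1) (hQ : Integrable (fun x => ‖x‖ ^ 2 * Real.exp (f x)) γ) :
    entropy γ (fun x => Real.exp (f x)) ≤
      ((1 / 2 * (∫ x, ‖x‖ ^ 2 * Real.exp (f x) ∂γ) - (n : ℝ) / 2 : ℝ) : EReal)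
        + (((n : ℝ) / 2 : ℝ) : EReal) *
            extLog (1 + ((1 / (n : ℝ) : ℝ) : EReal) *
              (extIntegral γ (fun x => ((‖gradient f x‖ ^ 2 * Real.exp (f x) : ℝ) : EReal))
                + (((n : ℝ) - ∫ x, ‖x‖ ^ 2 * Real.exp (f x) ∂γ : ℝ) : EReal))) := by
  have hn' : (0 : ℝ) < n := by exact_mod_cast hn
  have hgc := continuous_gradient hf
  have hfc := hf.continuous
  have hc : Continuous fun x : EuclideanSpace ℝ (Fin n) => ‖x‖ ^ 2 / 2 := by fun_prop
  have hC : ContDiff ℝ 1 fun x : EuclideanSpace ℝ (Fin n) => ‖x‖ ^ 2 / 2 :=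
    (contDiff_norm_sq ℝ).div_const 2
  have hnn : ∀ x, 0 ≤ ‖gradient f x‖ ^ 2 * Real.exp (f x) := fun x => by positivity
  by_cases hK : Integrable (fun x => ‖gradient f x‖ ^ 2 * Real.exp (f x)) γ
  swap
  -- With infinite Fisher information the right side is `+∞`.
  · have htop : extIntegral γ (fun x => ((‖gradient f x‖ ^ 2 * Real.exp (f x) : ℝ) : EReal)) = ⊤ := by
      rw [extIntegral_of_nonneg fun x => by exact_mod_cast hnn x]
      simp only [EReal.real_coe_toENNReal, EReal.coe_ennreal_eq_top_iff]
      by_contra ht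
      refine hK ⟨by fun_prop, ?_⟩
      rw [hasFiniteIntegral_iff_ofReal (Eventually.of_forall hnn)]
      exact lt_top_iff_ne_top.2 ht
    rw [htop, EReal.top_add_coe, EReal.mul_top_of_pos (by exact_mod_cast one_div_pos.2 hn'),
      ← EReal.coe_one, EReal.coe_add_top, extLog_top,
      EReal.mul_top_of_pos (by exact_mod_cast half_pos hn'), EReal.coe_add_top]
    exact le_top
  rw [extIntegral_coe hK]
  have main := entropy_gibbsMeasure_le hn Real.HolderConjugate.two_two hC
    isHomogeneousOfDegree_norm_sq_div_two integrable_exp_neg_norm_sq_div_two hf (hγ.symm ▸ hf1)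
  simp only [legendreTransform_norm_sq_div_two, gradient_norm_sq_div_two_sub hf,
    ← EReal.coe_mul] at main
  set β := Real.log (∫ y : EuclideanSpace ℝ (Fin n), Real.exp (-(‖y‖ ^ 2 / 2))) with hβ
  set H : EuclideanSpace ℝ (Fin n) → ℝ := fun x => ‖x‖ ^ 2 / 2 - f x + β with hH
  have hHC : ContDiff ℝ 1 H := (hC.sub hf).add contDiff_const
  have hgH : ∀ x, gradient H x = x - gradient f x := fun x => by
    rw [← gradient_norm_sq_div_two_sub hf]
    simp only [gradient, hH, fderiv_add_const]
  have hexp : ∀ x, Real.exp (f x) * Real.exp (-(‖x‖ ^ 2 / 2) - β) = Real.exp (-H x) := fun x => by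
    rw [← Real.exp_add]; congr 1; simp only [hH]; ring
  have toI : ∀ {u : EuclideanSpace ℝ (Fin n) → ℝ}, Integrable (fun x => u x * Real.exp (f x)) γ ↔
      Integrable fun x => u x * Real.exp (-H x) := fun {u} => by
    rw [← hγ, integrable_gibbsMeasure_iff hc, ← hβ]
    simp only [mul_assoc, hexp]
  have toE : ∀ u : EuclideanSpace ℝ (Fin n) → ℝ, ∫ x, u x * Real.exp (f x) ∂γ =
      ∫ x, u x * Real.exp (-H x) := fun u => by
    rw [← hγ, integral_gibbsMeasure hc, ← hβ]
    simp only [mul_assoc, hexp]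
  have hfi : Integrable (fun x => Real.exp (f x)) γ := by
    by_contra hc
    rw [integral_undef hc] at hf1
    exact zero_ne_one hf1
  have hHi : Integrable fun x => Real.exp (-H x) := by
    simpa using (toI (u := fun _ => 1)).1 (by simpa using hfi)
  have hH1 : ∫ x, Real.exp (-H x) = 1 := by
    simpa [hf1] using (toE fun _ => 1).symm
  have hQ' := toI.1 hQ
  have hK' := toI.1 hK
  have hA' : Integrable fun x => ‖gradient H x‖ ^ 2 * Real.exp (-H x) := by
    have hHc := hHC.continuous
    have hgHc := continuous_gradient hHC
    refine ((hQ'.add hK').const_mul 2).mono' (by fun_prop) (Eventually.of_forall fun x => ?_)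
    rw [Real.norm_of_nonneg (by positivity), hgH, Pi.add_apply, ← add_mul, ← mul_assoc]
    refine mul_le_mul_of_nonneg_right ?_ (Real.exp_pos _).le
    have h1 := norm_sub_le x (gradient f x)
    have h0 := norm_nonneg (x - gradient f x)
    nlinarith [sq_nonneg (‖x‖ - ‖gradient f x‖)]
  obtain ⟨hB, hBe⟩ := integral_inner_gradient_mul_exp_neg hHC hHi hQ' hA'
  -- Expand `|x - ∇H|²`; the cross term integrates to `-2n` by parts, which turns `∫ |∇H|² e^{-H}`
  -- into the argument of the Bakry–Ledoux logarithm.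
  have hKe : ∫ x, ‖gradient f x‖ ^ 2 * Real.exp (-H x) = (∫ x, ‖x‖ ^ 2 * Real.exp (-H x)) +
      -2 * (∫ x, ⟪x, gradient H x⟫ * Real.exp (-H x)) +
        ∫ x, ‖gradient H x‖ ^ 2 * Real.exp (-H x) := by
    rw [← integral_const_mul, ← integral_add_add hQ' (hB.const_mul _) hA']
    refine integral_congr_ae (Eventually.of_forall fun x => ?_)
    have : gradient f x = x - gradient H x := by rw [hgH]; abel
    simp only
    rw [this, norm_sub_sq_real]
    ring
  rw [hBe, hH1, mul_one] at hKe
  have hA : Integrable (fun x => ‖x - gradient f x‖ ^ 2 / 2 * Real.exp (f x)) γ := by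
    rw [toI]
    refine (hA'.const_mul (1 / 2)).congr (Eventually.of_forall fun x => ?_)
    simp only [hgH]
    ring
  have hAe : ∫ x, ‖x - gradient f x‖ ^ 2 / 2 * Real.exp (f x) ∂γ =
      1 / 2 * ∫ x, ‖gradient H x‖ ^ 2 * Real.exp (-H x) := by
    rw [toE, ← integral_const_mul]
    refine integral_congr_ae (Eventually.of_forall fun x => ?_)
    simp only [hgH]
    ring
  have hVe : ∫ x, ‖x‖ ^ 2 / 2 * Real.exp (f x) ∂γ = 1 / 2 * ∫ x, ‖x‖ ^ 2 * Real.exp (f x) ∂γ := by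
    rw [← integral_const_mul]
    refine integral_congr_ae (Eventually.of_forall fun x => ?_)
    simp only
    ring
  have hVi : Integrable (fun x => ‖x‖ ^ 2 / 2 * Real.exp (f x)) γ := by
    refine (hQ.const_mul (1 / 2)).congr (Eventually.of_forall fun x => ?_)
    simp only
    ring
  rw [hγ, extIntegral_coe hA, extIntegral_coe hVi, hAe, hVe, ← EReal.coe_mul] at main
  refine main.trans (le_of_eq ?_)
  rw [← EReal.coe_add, ← EReal.coe_mul, ← EReal.coe_one, ← EReal.coe_add]
  have earg : 2 / (n : ℝ) * (1 / 2 * ∫ x, ‖gradient H x‖ ^ 2 * Real.exp (-H x)) =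
      1 + 1 / n * ((∫ x, ‖gradient f x‖ ^ 2 * Real.exp (f x) ∂γ) +
        (n - ∫ x, ‖x‖ ^ 2 * Real.exp (f x) ∂γ)) := by
    rw [toE, toE, hKe]
    field_simp
    ring
  rw [earg, add_assoc, add_comm, ← EReal.coe_add]
  congr 2
  ring

end Gaussian

theorem corollary1p2 (n : ℕ) (hn : 0 < n) :
    (∀ (p q : ℝ) (V₀ : EuclideanSpace ℝ (Fin n) → ℝ), 1 < q → 1 / p + 1 / q = 1 →
      ContDiff ℝ 1 V₀ → IsHomogeneousOfDegree q V₀ →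
      Integrable (fun x => Real.exp (-V₀ x)) →
      ∀ f : EuclideanSpace ℝ (Fin n) → ℝ, ContDiff ℝ 1 f →
        ∫ x, Real.exp (f x) ∂(gibbsMeasure V₀) = 1 →
        entropy (gibbsMeasure V₀) (fun x => Real.exp (f x)) ≤
          (((n : ℝ) / p : ℝ) : EReal) *
              extLog (((p / (n : ℝ) : ℝ) : EReal) *
                extIntegral (gibbsMeasure V₀) (fun x =>
                  legendreTransform V₀ (gradient (fun y => V₀ y - f y) x) *
                    ((Real.exp (f x) : ℝ) : EReal)))
            + (((n : ℝ) * ((1 - p) / p) : ℝ) : EReal)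
            + extIntegral (gibbsMeasure V₀) (fun x => ((V₀ x * Real.exp (f x) : ℝ) : EReal))) ∧
    gibbsMeasure (fun x : EuclideanSpace ℝ (Fin n) => ‖x‖ ^ 2 / 2) =
      ProbabilityTheory.stdGaussian (EuclideanSpace ℝ (Fin n)) ∧
    (∀ f : EuclideanSpace ℝ (Fin n) → ℝ, ContDiff ℝ 1 f →
      ∫ x, Real.exp (f x) ∂(ProbabilityTheory.stdGaussian (EuclideanSpace ℝ (Fin n))) = 1 →
      Integrable (fun x => ‖x‖ ^ 2 * Real.exp (f x))
        (ProbabilityTheory.stdGaussian (EuclideanSpace ℝ (Fin n))) →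
      entropy (ProbabilityTheory.stdGaussian (EuclideanSpace ℝ (Fin n)))
          (fun x => Real.exp (f x)) ≤
        ((1 / 2 * (∫ x, ‖x‖ ^ 2 * Real.exp (f x)
              ∂(ProbabilityTheory.stdGaussian (EuclideanSpace ℝ (Fin n)))) - (n : ℝ) / 2 : ℝ)
            : EReal)
          + (((n : ℝ) / 2 : ℝ) : EReal) *
              extLog (1 + ((1 / (n : ℝ) : ℝ) : EReal) *
                (extIntegral (ProbabilityTheory.stdGaussian (EuclideanSpace ℝ (Fin n)))
                    (fun x => ((‖gradient f x‖ ^ 2 * Real.exp (f x) : ℝ) : EReal))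
                  + (((n : ℝ) - ∫ x, ‖x‖ ^ 2 * Real.exp (f x)
                      ∂(ProbabilityTheory.stdGaussian (EuclideanSpace ℝ (Fin n))) : ℝ)
                        : EReal)))) := by
  refine ⟨fun p q V₀ hq hpq hV hVh hVi f hf hf1 => ?_, gibbsMeasure_norm_sq_div_two,
    fun f hf hf1 hQ => entropy_gaussian_le hn hf gibbsMeasure_norm_sq_div_two hf1 hQ⟩
  have hconj : p.HolderConjugate q :=
    (Real.holderConjugate_iff.2 ⟨hq, by simpa [add_comm] using hpq⟩).symm
  exact entropy_gibbsMeasure_le hn hconj hV hVh hVi hf hf1
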